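/- Let $n\ge 2$ and let $G_2^*(\mathbb R^{n+3})=\mathrm{SO}_0(2,n+1)/(\mathrm{SO}(2)\times \mathrm{SO}(n+1))$ be the noncompact real two-plane Grassmannian with origin $o$, where $\mathfrak{so}(2,n+1)=\{X\in M_{n+3}(\mathbb R)\mid {}^tX I+IX=0\}$, $I=\mathrm{diag}(-1,-1,1,\dots,1)$. Write $\mathfrak{so}(2,n+1)=\mathfrak k\oplus\mathfrak p$ for the Cartan decomposition ($\mathfrak k$ the skew-symmetric and $\mathfrak p$ the symmetric matrices), $T_o\cong\mathfrak p$, put $c=2\sqrt2$ and let $U=\begin{pmatrix}0&1\\-1&0\end{pmatrix}$, $V=\begin{pmatrix}0&1\\1&0\end{pmatrix}$. Equip the Grassmannian with the $\mathrm{SO}_0(2,n+1)$-invariant Kähler structure $(g,J)$ that is given on $\mathfrak p$ by $g(X,Y)=c^{-2}\operatorname{tr}({}^tXY)$ and $J=\operatorname{ad}(Z)$, where $Z$ has upper left $2\times2$ block $U$ and zeros elsewhere. With $E_{ij}$ the matrix units, and matrices written in blocks of sizes $2,2,n-1$, put $$A_1=\tfrac c2\big((E_{13}+E_{31})-(E_{24}+E_{42})\big),\qquad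 A_2=\tfrac c2\big((E_{13}+E_{31})+(E_{24}+E_{42})\big),$$ $$X_0=\tfrac c2\begin{pmatrix}U&V&0\\V&U&0\\0&0&0\end{pmatrix},\qquad W_0=\tfrac c2\begin{pmatrix}-U&U&0\\-U&U&0\\0&0&0\end{pmatrix},\qquad R(e)=\tfrac c{\sqrt2}\begin{pmatrix}0&0&e\\0&0&e\\{}^te&-{}^te&0\end{pmatrix},$$ and $Z_i=R(e_{1i})$, $Y_i=R(e_{2i})$ for $1\le i\le n-1$, where $e_{ki}$ are the matrix units of $M_{2,n-1}(\mathbb R)$. Let $\mathfrak s=\mathfrak a\oplus\mathfrak n$ with $\mathfrak a=\mathrm{Span}\{A_1,A_2\}$ and $\mathfrak n=\mathrm{Span}\{X_0,Y_i,Z_i,W_0\}$ be the solvable part of the Iwasawa decomposition, with the inner product pulled back from $T_o$ by $X\mapsto\frac{d}{dt}\big|_{t=0}\exp(tX).o$. Let $N=\frac1{\sqrt2}(-A_1-A_2)$, let $\mathfrak s_N=\mathfrak s\ominus\mathbb RN$ be the orthogonal complement of $N$ in $\mathfrak s$, and let $S_N$ be the connected Lie subgroup with Lie algebra $\mathfrak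 s_N$. Then $a\mapsto a.o$ is a homeomorphism from $S_N$ onto the orbit $S_N.o$, and $S_N.o$ is an embedded real hypersurface of $G_2^*(\mathbb R^{n+3})$, of dimension $2n+1$, on which $\nu_{a.o}=a_*\big(\frac{d}{dt}\big|_{t=0}\exp(tN).o\big)$ $(a\in S_N)$ is a smooth unit normal vector field. On $S_N.o$ let $g$ be the induced metric and put $$\xi=-J\nu,\qquad \eta(X)=g(X,\xi),\qquad \varphi X=JX-\eta(X)\nu .$$ Then $(\eta,\xi,\varphi,g)$ is a contact metric structure on $S_N.o$. That is, it is an almost contact metric structure (all four tensor fields are smooth, $\eta(\xi)=1$, $\varphi^2X=-X+\eta(X)\xi$ and $g(\varphi X,\varphi Y)=g(X,Y)-\eta(X)\eta(Y)$), and $\Phi=d\eta$, where $\Phi(X,Y)=g(X,\varphi Y)$ and $2\,d\eta(X,Y)=X(\eta(Y))-Y(\eta(X))-\eta([X,Y])$ for vector fields $X,Y$. -/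

import Mathlib

open scoped Manifold ContDiff Bundle Matrix.Norms.L2Operator

noncomputable section

namespace LieHypersurface

/-- The differential at `x` of a map from a manifold to a normed space. -/
def differential {E : Type*} [NormedAddCommGroup E] [NormedSpace ℝ E]
    {H : Type*} [TopologicalSpace H] (I : ModelWithCorners ℝ E H)
    {M : Type*} [TopologicalSpace M] [ChartedSpace H M]
    {W : Type*} [NormedAddCommGroup W] [NormedSpace ℝ W] (f : M → W) (x : M) :
    TangentSpace I x →L[ℝ] W :=
  mfderiv I 𝓘(ℝ, W) f x

/-! ### Contact metric structures on a smooth manifold -/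

section Contact

variable {E : Type*} [NormedAddCommGroup E] [NormedSpace ℝ E]
  {H : Type*} [TopologicalSpace H] (I : ModelWithCorners ℝ E H)
  (M : Type*) [TopologicalSpace M] [ChartedSpace H M] [IsManifold I ∞ M]

/-- An almost contact metric structure `(η, ξ, φ, g)` on `M`, all tensor fields being smooth. -/
structure AlmostContactMetricStructure where
  /-- the Riemannian metric -/
  g : Bundle.ContMDiffRiemannianMetric I ∞ E (fun x : M => TangentSpace I x)
  /-- the characteristic vector field -/
  ξ : ∀ x : M, TangentSpace I x
  /-- the `1`-form -/
  η : ∀ x : M, TangentSpace I x →L[ℝ] ℝ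
  /-- the `(1,1)`-tensor field -/
  φ : ∀ x : M, TangentSpace I x →L[ℝ] TangentSpace I x
  smooth_ξ : ContMDiff I I.tangent ∞ (fun x => (⟨x, ξ x⟩ : TangentBundle I M))
  smooth_η : ContMDiff I (I.prod 𝓘(ℝ, E →L[ℝ] ℝ)) ∞
    (fun x => Bundle.TotalSpace.mk' (E →L[ℝ] ℝ)
      (E := fun x : M => TangentSpace I x →L[ℝ] Bundle.Trivial M ℝ x) x (η x))
  smooth_φ : ContMDiff I (I.prod 𝓘(ℝ, E →L[ℝ] E)) ∞
    (fun x => Bundle.TotalSpace.mk' (E →L[ℝ] E)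
      (E := fun x : M => TangentSpace I x →L[ℝ] TangentSpace I x) x (φ x))
  η_ξ : ∀ x, η x (ξ x) = 1
  φ_φ : ∀ x (u : TangentSpace I x), φ x (φ x u) = -u + η x u • ξ x
  g_φ_φ : ∀ x (u v : TangentSpace I x),
    g.inner x (φ x u) (φ x v) = g.inner x u v - η x u * η x v

variable {M}

/-- The value at `x` of `dη (X, Y)`, in the normalization
`2 dη(X, Y) = X (η(Y)) - Y (η(X)) - η([X, Y])`. -/
def extDerivOneForm (η : ∀ x : M, TangentSpace I x →L[ℝ] ℝ)
    (X Y : ∀ x : M, TangentSpace I x) (x : M) : ℝ :=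
  (1 / 2) * (differential I (fun y => η y (Y y)) x (X x)
    - differential I (fun y => η y (X y)) x (Y x)
    - η x (VectorField.mlieBracket I X Y x))

variable {I}

/-- The fundamental `2`-form `Φ(u, v) = g(u, φ v)`. -/
def AlmostContactMetricStructure.fundamentalForm (s : AlmostContactMetricStructure I M)
    (x : M) (u v : TangentSpace I x) : ℝ :=
  s.g.inner x u (s.φ x v)

/-- The contact metric condition `Φ = dη`, tested on all vector fields near each point. -/
def AlmostContactMetricStructure.IsContactMetric (s : AlmostContactMetricStructure I M) : Prop :=
  ∀ (x : M) (X Y : ∀ y : M, TangentSpace I y),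
    ContMDiffAt I I.tangent ∞ (fun y => (⟨y, X y⟩ : TangentBundle I M)) x →
    ContMDiffAt I I.tangent ∞ (fun y => (⟨y, Y y⟩ : TangentBundle I M)) x →
    s.fundamentalForm x (X x) (Y x) = extDerivOneForm I s.η X Y x

end Contact

/-! ### The noncompact real two-plane Grassmannian -/

/-- The coordinates of `ℝ^{n+3}`, in blocks of sizes `2, 2, n - 1`. -/
abbrev Idx (n : ℕ) : Type := Fin 2 ⊕ (Fin 2 ⊕ Fin (n - 1))

/-- Real square matrices of size `n + 3`. -/
abbrev Mat (n : ℕ) : Type := Matrix (Idx n) (Idx n) ℝ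

/-- The Lie algebra `𝔰𝔬(2, n + 1)`. -/
def so (n : ℕ) : Submodule ℝ (Mat n) :=
  skewAdjointMatricesSubmodule
    (LieAlgebra.Orthogonal.indefiniteDiagonal (Fin 2) (Fin 2 ⊕ Fin (n - 1)) ℝ)

/-- The subgroup generated by `exp 𝔥`; if `𝔥` is a Lie subalgebra, this is the connected Lie
subgroup with Lie algebra `𝔥`. -/
def connectedLieSubgroup {n : ℕ} (𝔥 : Submodule ℝ (Mat n)) : Subgroup (GL (Idx n) ℝ) :=
  Subgroup.closure {a | ∃ X ∈ 𝔥, (a : Mat n) = NormedSpace.exp X}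

/-- The identity component `SO₀(2, n + 1)`. -/
def SO₀ (n : ℕ) : Subgroup (GL (Idx n) ℝ) :=
  connectedLieSubgroup (so n)

/-- The matrix of rotation by a right angle. -/
def U : Matrix (Fin 2) (Fin 2) ℝ := !![0, 1; -1, 0]

/-- The matrix of the exchange of the two coordinates. -/
def V : Matrix (Fin 2) (Fin 2) ℝ := !![0, 1; 1, 0]

/-- The block matrix with third block row and third block column equal to zero. -/
def block (n : ℕ) (a b c d : Matrix (Fin 2) (Fin 2) ℝ) : Mat n :=
  Matrix.fromBlocks a (Matrix.fromCols b 0) (Matrix.fromRows c 0) (Matrix.fromBlocks d 0 0 0)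

/-- The element `Z` of the center of `𝔨 = 𝔰𝔬(2) ⊕ 𝔰𝔬(n + 1)` that defines the complex structure. -/
def Z (n : ℕ) : Mat n := block n U 0 0 0

/-- The conjugation action of invertible matrices on matrices. -/
def Ad {n : ℕ} (a : GL (Idx n) ℝ) (p : Mat n) : Mat n :=
  (a : Mat n) * p * ((a⁻¹ : GL (Idx n) ℝ) : Mat n)

/-- `G₂*(ℝ^{n+3}) = SO₀(2, n + 1) / (SO(2) × SO(n + 1))`. The denominator is the stabilizer of `Z`
under conjugation, and the quotient is realized as the orbit of `Z`, with `Z` as the origin `o`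
(the point `p` corresponds to the definite `2`-plane that is the image of `p`). -/
def grassmannian (n : ℕ) : Set (Mat n) := {p | ∃ a ∈ SO₀ n, p = Ad a (Z n)}

/-- The velocity at `p` of the curve `t ↦ exp (t X) . p`. For `X ∈ 𝔭` and `p = o` this is the usual
identification of `𝔭` with the tangent space at `o`. -/
def velocity {n : ℕ} (X p : Mat n) : Mat n := X * p - p * X

/-- `u` is tangent to the Grassmannian at its point `p`. -/
def IsTangent {n : ℕ} (p u : Mat n) : Prop := ∃ X ∈ so n, u = velocity X p

/-- The scaling `c = 2 √2`; the minimal sectional curvature is `-c²`. -/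
def c₀ : ℝ := 2 * Real.sqrt 2

/-- The `SO₀(2, n + 1)`-invariant metric of the Grassmannian on tangent vectors (at any point).
At `o` the tangent space is `𝔭`, where the matrices are symmetric, and this is
`c⁻² tr (ᵗu v)`. -/
def metric {n : ℕ} (u v : Mat n) : ℝ := (1 / c₀ ^ 2) * Matrix.trace (u * v)

/-- The `SO₀(2, n + 1)`-invariant complex structure of the Grassmannian at the point `p`, on tangent
vectors. At `o` it is `ad Z` on `𝔭`. -/
def J {n : ℕ} (p u : Mat n) : Mat n := p * u - u * p

/-! ### The solvable model and the group `S_N` -/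

/-- `A₁`. -/
def A₁ (n : ℕ) : Mat n := (c₀ / 2) • block n 0 !![1, 0; 0, -1] !![1, 0; 0, -1] 0

/-- `A₂`. -/
def A₂ (n : ℕ) : Mat n := (c₀ / 2) • block n 0 1 1 0

/-- `X₀`, a root vector. -/
def X₀ (n : ℕ) : Mat n := (c₀ / 2) • block n U V V U

/-- `W₀`, a root vector. -/
def W₀ (n : ℕ) : Mat n := (c₀ / 2) • block n (-U) U (-U) U

/-- The root vectors `Z_i` (`k = 0`) and `Y_i` (`k = 1`). -/
def shortRoot (n : ℕ) (k : Fin 2) (i : Fin (n - 1)) : Mat n :=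
  (c₀ / Real.sqrt 2) •
    Matrix.fromBlocks 0
      (Matrix.fromCols 0 (Matrix.single k i 1))
      (Matrix.fromRows 0 (Matrix.single i k 1))
      (Matrix.fromBlocks 0 (Matrix.single k i 1) (-Matrix.single i k 1) 0)

/-- The solvable part `𝔰 = 𝔞 ⊕ 𝔫` of the Iwasawa decomposition of `𝔰𝔬(2, n + 1)`, with
`𝔞 = Span {A₁, A₂}` and `𝔫 = Span {X₀, Y_i, Z_i, W₀}`. -/
def solvablePart (n : ℕ) : Submodule ℝ (Mat n) :=
  Submodule.span ℝ ({A₁ n, A₂ n, X₀ n, W₀ n} ∪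
    Set.range (shortRoot n 0) ∪ Set.range (shortRoot n 1))

/-- The inner product of the solvable model, induced from the metric at `o` by `X ↦ d/dt exp(tX).o`.
The basis `A₁, A₂, X₀, Y_i, Z_i, W₀` of `𝔰` is orthonormal. -/
def modelInner {n : ℕ} (X Y : Mat n) : ℝ := metric (velocity X (Z n)) (velocity Y (Z n))

/-- The unit vector `N = (1/√2) (-A₁ - A₂) ∈ 𝔞`. -/
def N (n : ℕ) : Mat n := (1 / Real.sqrt 2) • (-A₁ n - A₂ n)

/-- `𝔰_N = 𝔰 ⊖ ℝ N`. -/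
def sN (n : ℕ) : Submodule ℝ (Mat n) where
  carrier := {X | X ∈ solvablePart n ∧ modelInner X (N n) = 0}
  zero_mem' := ⟨Submodule.zero_mem _, by simp [modelInner, metric, velocity]⟩
  add_mem' := by
    rintro X Y ⟨hX, hX'⟩ ⟨hY, hY'⟩
    refine ⟨Submodule.add_mem _ hX hY, ?_⟩
    have h : velocity (X + Y) (Z n) = velocity X (Z n) + velocity Y (Z n) := by
      simp only [velocity, add_mul, mul_add]; abel
    simp only [modelInner, metric] at hX' hY' ⊢
    rw [h, add_mul, Matrix.trace_add, mul_add, hX', hY', add_zero]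
  smul_mem' := by
    rintro r X ⟨hX, hX'⟩
    refine ⟨Submodule.smul_mem _ r hX, ?_⟩
    have h : velocity (r • X) (Z n) = r • velocity X (Z n) := by
      simp only [velocity, smul_mul_assoc, mul_smul_comm, smul_sub]
    simp only [modelInner, metric] at hX' ⊢
    rw [h, smul_mul_assoc, Matrix.trace_smul, smul_eq_mul, mul_left_comm, hX', mul_zero]

/-- The connected Lie group `S_N` with Lie algebra `𝔰_N`. -/
def SN (n : ℕ) : Subgroup (GL (Idx n) ℝ) := connectedLieSubgroup (sN n)

/-- The Lie hypersurface `S_N.o`. -/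
def orbitSN (n : ℕ) : Set (Mat n) := {p | ∃ a ∈ SN n, p = Ad a (Z n)}

/-! ### Real hypersurfaces of the Grassmannian and their induced structures -/

section Hypersurface

variable {n : ℕ} {E : Type*} [NormedAddCommGroup E] [NormedSpace ℝ E]
  {H : Type*} [TopologicalSpace H] (I : ModelWithCorners ℝ E H)
  {M : Type*} [TopologicalSpace M] [ChartedSpace H M]

/-- `f` embeds the manifold `M` as a real hypersurface of the Grassmannian, and `ν` is a smooth
unit normal vector field along `f`. -/
structure IsHypersurfaceWithUnitNormal (f : M → Mat n) (ν : M → Mat n) : Prop where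
  isEmbedding : Topology.IsEmbedding f
  contMDiff : ContMDiff I 𝓘(ℝ, Mat n) ∞ f
  injective_mfderiv : ∀ x, Function.Injective (differential I f x)
  mem : ∀ x, f x ∈ grassmannian n
  contMDiff_normal : ContMDiff I 𝓘(ℝ, Mat n) ∞ ν
  isTangent_normal : ∀ x, IsTangent (f x) (ν x)
  unit : ∀ x, metric (ν x) (ν x) = 1
  normal : ∀ x (u : TangentSpace I x), metric (differential I f x u) (ν x) = 0
  /-- the tangent space of the Grassmannian is the direct sum of that of `M` and of `ℝ ν` -/
  codim_one : ∀ x (w : Mat n), IsTangent (f x) w ↔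
    ∃ (u : TangentSpace I x) (r : ℝ), w = differential I f x u + r • ν x

/-- `s` is the structure that the Grassmannian induces on its hypersurface `f : M → G₂*(ℝ^{n+3})`
with unit normal field `ν`: the metric is induced, `ξ = -J ν`, `η(u) = g(u, ξ)` and
`φ u = J u - η(u) ν`. -/
structure IsInducedStructure [IsManifold I ∞ M] (f : M → Mat n) (ν : M → Mat n)
    (s : AlmostContactMetricStructure I M) : Prop where
  metric_eq : ∀ x (u v : TangentSpace I x), s.g.inner x u v =
    metric (differential I f x u) (differential I f x v)
  ξ_eq : ∀ x, differential I f x (s.ξ x) = -J (f x) (ν x)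
  η_eq : ∀ x (u : TangentSpace I x), s.η x u = s.g.inner x u (s.ξ x)
  φ_eq : ∀ x (u : TangentSpace I x), differential I f x (s.φ x u) =
    J (f x) (differential I f x u) - s.η x u • ν x

end Hypersurface

end LieHypersurface

end

/-! Write ⟨·,·⟩ for the form of signature (2, n+1) and v = e₁ + e₃ for the isotropic vector that S_N
fixes. For a in S_N put F₁ = a e₁ and F₂ = a e₂, an orthonormal basis of the plane that represents
a.o. Since Z v = -e₂ and Z² v = -e₁, the point p = a.o satisfies p v = -F₂ and p² v = -F₁. So the
orbit carries a canonical frame, with F₁ the orthogonal projection of v to the plane, and the frame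
is polynomial in p.

The geometric reason for Φ = dη is that the Kähler form of the Grassmannian is a constant multiple
of the curvature of the tautological plane bundle. This bundle has the abelian structure group
SO(2), so its curvature is the exterior derivative of the connection form ⟨F₁, dF₂⟩ of any frame.
Two identities make this precise, and both are checked at o after translation by the group: η =
-(1/2)⟨F₁, dF₂⟩ (`metric_fderiv_point_J_normalAt`) and Φ(u, w) = -(1/4)(⟨dF₁ u, dF₂ w⟩ - ⟨dF₁ w, dF₂
u⟩) (`metric_J_fderiv_point`). In the derivative of η the Hessian of F₂ is symmetric and drops out
of dη, which leaves Φ (`chartMetric_chartφ_eq`). The constants agree because of the scaling c² = 8: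
rescaling g multiplies Φ by the factor and η only by its square root.

The manifold structure is explicit. Preservation of the form, of v and of a flag shows that (F₁, F₂)
is determined by 2n+1 free real parameters (`exists_frame_eq`), that all parameter values occur
(`groupElement`), and that the frame determines a (`PreservesFlag.eq_one`). Hence the orbit has one
global chart, the orbit map is a homeomorphism onto the orbit, and all differential geometry becomes
calculus on a vector space. The almost contact identities are the usual formal consequences of J² =
-1, of the skewness of J, and of ν being a unit normal. -/

noncomputable section

namespace LieHypersurface

/-! ### Calculus on a manifold with a single global chart -/

section ConstantChart

variable {E : Type*} [NormedAddCommGroup E] [NormedSpace ℝ E]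
  {M : Type*} [TopologicalSpace M] [ChartedSpace E M] (e : M ≃ₜ E)

/-- The manifold `M` is described by the single global chart `e`. -/
def IsGlobalChart : Prop :=
  ∀ x : M, chartAt E x = e.toOpenPartialHomeomorph

variable {e} (he : IsGlobalChart e)
include he

theorem IsGlobalChart.extChartAt_coe (x : M) :
    (extChartAt 𝓘(ℝ, E) x : M → E) = e := by
  simp [extChartAt, he x]

theorem IsGlobalChart.extChartAt_symm_coe (x : M) :
    ((extChartAt 𝓘(ℝ, E) x).symm : E → M) = e.symm := by
  simp [extChartAt, he x]

theorem IsGlobalChart.contMDiffAt_iff {W : Type*} [NormedAddCommGroup W] [NormedSpace ℝ W]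
    {f : M → W} {k : WithTop ℕ∞} {x : M} :
    ContMDiffAt 𝓘(ℝ, E) 𝓘(ℝ, W) k f x ↔ ContDiffAt ℝ k (f ∘ e.symm) (e x) := by
  rw [_root_.contMDiffAt_iff]
  simp only [he.extChartAt_coe, he.extChartAt_symm_coe, extChartAt_model_space_eq_id,
    modelWithCornersSelf_coe, Set.range_id, contDiffWithinAt_univ, PartialEquiv.refl_coe,
    Function.id_comp]
  refine ⟨fun h => h.2, fun h => ⟨?_, h⟩⟩
  have := h.continuousAt.comp (f := e) (x := x) e.continuous.continuousAt
  simpa [Function.comp_def] using this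

theorem IsGlobalChart.contMDiff_iff {W : Type*} [NormedAddCommGroup W] [NormedSpace ℝ W]
    {f : M → W} {k : WithTop ℕ∞} :
    ContMDiff 𝓘(ℝ, E) 𝓘(ℝ, W) k f ↔ ContDiff ℝ k (f ∘ e.symm) := by
  rw [contDiff_iff_contDiffAt]
  refine ⟨fun h t => ?_, fun h x => he.contMDiffAt_iff.2 (h _)⟩
  simpa using he.contMDiffAt_iff.1 (h (e.symm t))

theorem IsGlobalChart.mfderiv_eq {W : Type*} [NormedAddCommGroup W] [NormedSpace ℝ W]
    {f : M → W} {x : M} (hf : DifferentiableAt ℝ (f ∘ e.symm) (e x)) :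
    mfderiv 𝓘(ℝ, E) 𝓘(ℝ, W) f x = fderiv ℝ (f ∘ e.symm) (e x) := by
  have hd : MDifferentiableAt 𝓘(ℝ, E) 𝓘(ℝ, W) f x := by
    rw [mdifferentiableAt_iff]
    refine ⟨?_, ?_⟩
    · have := hf.continuousAt.comp (f := e) (x := x) e.continuous.continuousAt
      simpa [Function.comp_def] using this
    · simp only [writtenInExtChartAt, he.extChartAt_coe, he.extChartAt_symm_coe,
        extChartAt_model_space_eq_id, modelWithCornersSelf_coe, Set.range_id,
        PartialEquiv.refl_coe, Function.id_comp]
      exact hf.differentiableWithinAt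
  rw [hd.mfderiv]
  simp only [writtenInExtChartAt, he.extChartAt_coe, he.extChartAt_symm_coe,
    extChartAt_model_space_eq_id, modelWithCornersSelf_coe, Set.range_id, fderivWithin_univ,
    PartialEquiv.refl_coe, Function.id_comp]
  rfl

theorem IsGlobalChart.differential_eq {W : Type*} [NormedAddCommGroup W] [NormedSpace ℝ W]
    {f : M → W} {x : M} (hf : DifferentiableAt ℝ (f ∘ e.symm) (e x)) :
    differential 𝓘(ℝ, E) f x = fderiv ℝ (f ∘ e.symm) (e x) :=
  he.mfderiv_eq hf

theorem IsGlobalChart.mfderivWithin_symm_eq (t : E) :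
    mfderivWithin 𝓘(ℝ, E) 𝓘(ℝ, E) e.symm Set.univ t = ContinuousLinearMap.id ℝ E := by
  have hd : MDifferentiableWithinAt 𝓘(ℝ, E) 𝓘(ℝ, E) e.symm Set.univ t := by
    rw [mdifferentiableWithinAt_iff]
    refine ⟨e.symm.continuous.continuousWithinAt, ?_⟩
    simp only [he.extChartAt_coe, extChartAt_model_space_eq_id,
      PartialEquiv.refl_coe, PartialEquiv.refl_symm, Function.comp_id]
    simp [Function.comp_def, differentiableWithinAt_fun_id]
  rw [hd.mfderivWithin]
  simp only [writtenInExtChartAt, he.extChartAt_coe, extChartAt_model_space_eq_id,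
      PartialEquiv.refl_coe, PartialEquiv.refl_symm, Function.comp_id]
  simp only [Function.comp_def, Homeomorph.apply_symm_apply, modelWithCornersSelf_coe,
    Set.range_id, Set.preimage_univ, Set.inter_univ, fderivWithin_univ]
  exact fderiv_id

/-- The derivative of the chart, read in the chart, is the identity, and so is that of its inverse.
The pullbacks in the definition of the bracket therefore leave the vector fields unchanged. -/
theorem IsGlobalChart.mlieBracket_eq (X Y : ∀ x : M, TangentSpace 𝓘(ℝ, E) x) (x : M) :
    VectorField.mlieBracket 𝓘(ℝ, E) X Y x =
      VectorField.lieBracket ℝ (fun t => (X (e.symm t) : E)) (fun t => (Y (e.symm t) : E))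
        (e x) := by
  have h1 : mfderiv 𝓘(ℝ, E) 𝓘(ℝ, E) (extChartAt 𝓘(ℝ, E) x) x = ContinuousLinearMap.id ℝ E := by
    rw [he.extChartAt_coe]
    refine (he.mfderiv_eq (f := e) ?_).trans ?_
    · simp [Function.comp_def]
    · simp only [Function.comp_def, Homeomorph.apply_symm_apply]
      exact fderiv_id
  have h3 (V : ∀ x : M, TangentSpace 𝓘(ℝ, E) x) : VectorField.mpullbackWithin 𝓘(ℝ, E) 𝓘(ℝ, E)
      (extChartAt 𝓘(ℝ, E) x).symm V (Set.range 𝓘(ℝ, E)) = fun t => (V (e.symm t) : E) := by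
    funext t
    rw [he.extChartAt_symm_coe, modelWithCornersSelf_coe, Set.range_id]
    refine (congrArg (fun L : E →L[ℝ] E => L.inverse (V (e.symm t)))
      (he.mfderivWithin_symm_eq t)).trans ?_
    simp only [ContinuousLinearMap.inverse_id]
    rfl
  rw [← VectorField.mlieBracketWithin_univ, VectorField.mlieBracketWithin_apply, h3, h3]
  refine (congrArg (fun L : E →L[ℝ] E => L.inverse _) h1).trans ?_
  simp only [ContinuousLinearMap.inverse_id, he.extChartAt_coe, modelWithCornersSelf_coe,
    Set.range_id, Set.preimage_univ, Set.inter_univ]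
  exact congrFun (VectorField.lieBracketWithin_univ (𝕜 := ℝ) (V := fun t => (X (e.symm t) : E))
    (W := fun t => (Y (e.symm t) : E))) (e x)

/-! ### Tensor fields and the exterior derivative in a global chart -/

section Bundle
variable [IsManifold 𝓘(ℝ, E) ∞ M]

/-- All preferred charts are `e`, so every transition map is the identity. This turns smoothness of
a section of a tensor bundle into smoothness of a function on `E`. -/
theorem IsGlobalChart.coordChange_eq (x y z : M) :
    (tangentBundleCore 𝓘(ℝ, E) M).coordChange (achart E x) (achart E y) z =
      ContinuousLinearMap.id ℝ E := by
  rw [tangentBundleCore_coordChange_achart, he.extChartAt_coe, he.extChartAt_symm_coe]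
  simp [Function.comp_def]

theorem IsGlobalChart.continuousLinearMapAt_eq (x y : M) :
    (trivializationAt E (TangentSpace 𝓘(ℝ, E) : M → Type _) x).continuousLinearMapAt ℝ y
      = ContinuousLinearMap.id ℝ E := by
  rw [TangentBundle.continuousLinearMapAt_trivializationAt_eq_core, he.coordChange_eq]
  simp [he x]

theorem IsGlobalChart.symmL_eq (x y : M) :
    (trivializationAt E (TangentSpace 𝓘(ℝ, E) : M → Type _) x).symmL ℝ y
      = ContinuousLinearMap.id ℝ E := by
  rw [TangentBundle.symmL_trivializationAt_eq_core, he.coordChange_eq]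
  simp [he x]

theorem IsGlobalChart.contMDiffAt_vectorField_iff {X : ∀ x : M, TangentSpace 𝓘(ℝ, E) x} {x : M} :
    ContMDiffAt 𝓘(ℝ, E) 𝓘(ℝ, E).tangent ∞
      (fun y => (⟨y, X y⟩ : TangentBundle 𝓘(ℝ, E) M)) x ↔
    ContDiffAt ℝ ∞ (fun t => (X (e.symm t) : E)) (e x) := by
  have h := Bundle.contMDiffAt_section (n := ∞) (IB := 𝓘(ℝ, E)) (F := E)
    (E := fun x : M => TangentSpace 𝓘(ℝ, E) x) (s := X) x
  refine h.trans ?_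
  have h2 : (fun y : M => (trivializationAt E (fun x : M => TangentSpace 𝓘(ℝ, E) x) x
      ⟨y, X y⟩).2) = fun y => (X y : E) := by
    funext y
    exact congrArg (fun L : E →L[ℝ] E => L (X y)) (he.coordChange_eq y x y)
  rw [h2]
  exact he.contMDiffAt_iff

theorem IsGlobalChart.covector_inCoordinates (x y : M) (L : E →L[ℝ] ℝ) :
    (trivializationAt (E →L[ℝ] ℝ)
      (fun x : M => TangentSpace 𝓘(ℝ, E) x →L[ℝ] Bundle.Trivial M ℝ x) x ⟨y, L⟩).2 = L := by
  refine ContinuousLinearMap.ext fun v => ?_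
  exact congrArg₂ (fun (S : E →L[ℝ] E) (T : ℝ →L[ℝ] ℝ) => T (L (S v))) (he.symmL_eq x y)
    (Bundle.Trivial.continuousLinearMapAt_trivialization ℝ M ℝ y)

theorem IsGlobalChart.contMDiff_covector {η : E → E →L[ℝ] ℝ} (h : ContDiff ℝ ∞ η) :
    ContMDiff 𝓘(ℝ, E) (𝓘(ℝ, E).prod 𝓘(ℝ, E →L[ℝ] ℝ)) ∞
    (fun x => Bundle.TotalSpace.mk' (E →L[ℝ] ℝ)
      (E := fun x : M => TangentSpace 𝓘(ℝ, E) x →L[ℝ] Bundle.Trivial M ℝ x) x (η (e x))) := by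
  intro x
  have key : ContMDiffAt 𝓘(ℝ, E) 𝓘(ℝ, E →L[ℝ] ℝ) ∞ (fun y => η (e y)) x :=
    he.contMDiff_iff.2 (by simpa [Function.comp_def] using h) x
  refine (Bundle.contMDiffAt_section (IB := 𝓘(ℝ, E)) (F := E →L[ℝ] ℝ)
    (E := fun x : M => TangentSpace 𝓘(ℝ, E) x →L[ℝ] Bundle.Trivial M ℝ x)
    (s := fun y => η (e y)) x).2
    (key.congr_of_eventuallyEq (Filter.Eventually.of_forall fun y => ?_))
  exact he.covector_inCoordinates x y (η (e y))

theorem IsGlobalChart.contMDiff_endomorphism {φ : E → E →L[ℝ] E} (h : ContDiff ℝ ∞ φ) :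
    ContMDiff 𝓘(ℝ, E) (𝓘(ℝ, E).prod 𝓘(ℝ, E →L[ℝ] E)) ∞
    (fun x => Bundle.TotalSpace.mk' (E →L[ℝ] E)
      (E := fun x : M => TangentSpace 𝓘(ℝ, E) x →L[ℝ] TangentSpace 𝓘(ℝ, E) x) x (φ (e x))) := by
  intro x
  have key : ContMDiffAt 𝓘(ℝ, E) 𝓘(ℝ, E →L[ℝ] E) ∞ (fun y => φ (e y)) x :=
    he.contMDiff_iff.2 (by simpa [Function.comp_def] using h) x
  refine (Bundle.contMDiffAt_section (IB := 𝓘(ℝ, E)) (F := E →L[ℝ] E)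
    (E := fun x : M => TangentSpace 𝓘(ℝ, E) x →L[ℝ] TangentSpace 𝓘(ℝ, E) x)
    (s := fun y => φ (e y)) x).2
    (key.congr_of_eventuallyEq (Filter.Eventually.of_forall fun y => ?_))
  refine ContinuousLinearMap.ext fun v => ?_
  exact congrArg₂ (fun L L' : E →L[ℝ] E => L' (φ (e y) (L v))) (he.symmL_eq x y)
      (he.continuousLinearMapAt_eq x y)

theorem IsGlobalChart.contMDiff_bilinForm {g : E → E →L[ℝ] E →L[ℝ] ℝ} (h : ContDiff ℝ ∞ g) :
    ContMDiff 𝓘(ℝ, E) (𝓘(ℝ, E).prod 𝓘(ℝ, E →L[ℝ] E →L[ℝ] ℝ)) ∞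
    (fun x => Bundle.TotalSpace.mk' (E →L[ℝ] E →L[ℝ] ℝ)
      (E := fun x : M => TangentSpace 𝓘(ℝ, E) x →L[ℝ] TangentSpace 𝓘(ℝ, E) x →L[ℝ] ℝ) x
      (g (e x))) := by
  intro x
  have key : ContMDiffAt 𝓘(ℝ, E) 𝓘(ℝ, E →L[ℝ] E →L[ℝ] ℝ) ∞ (fun y => g (e y)) x :=
    he.contMDiff_iff.2 (by simpa [Function.comp_def] using h) x
  refine (Bundle.contMDiffAt_section (IB := 𝓘(ℝ, E)) (F := E →L[ℝ] E →L[ℝ] ℝ)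
    (E := fun x : M => TangentSpace 𝓘(ℝ, E) x →L[ℝ] TangentSpace 𝓘(ℝ, E) x →L[ℝ] ℝ)
    (s := fun y => g (e y)) x).2
    (key.congr_of_eventuallyEq (Filter.Eventually.of_forall fun y => ?_))
  refine ContinuousLinearMap.ext fun v => ContinuousLinearMap.ext fun w => ?_
  have h1 := congrArg (fun L : E →L[ℝ] E => g (e y) (L v) w) (he.symmL_eq x y)
  refine Eq.trans ?_ h1
  have hy : y ∈ (trivializationAt (E →L[ℝ] ℝ)
      (fun x : M => TangentSpace 𝓘(ℝ, E) x →L[ℝ] ℝ) x).baseSet := by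
    change y ∈ (chartAt E x).source ∩ Set.univ
    simp [he x]
  have h2 := (trivializationAt (E →L[ℝ] ℝ)
      (fun x : M => TangentSpace 𝓘(ℝ, E) x →L[ℝ] ℝ) x).coe_linearMapAt_of_mem (R := ℝ) hy
  set S : E →L[ℝ] E := (trivializationAt E (TangentSpace 𝓘(ℝ, E) : M → Type _) x).symmL ℝ y
  exact congrArg (fun L : E →L[ℝ] ℝ => L w) ((congrFun h2 (g (e y) (S v))).trans
    (he.covector_inCoordinates x y (g (e y) (S v))))

omit he in
-- By compactness of the unit sphere, `B v v` is at least `m * ‖v‖ ^ 2` with a constant `m > 0`.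
theorem isVonNBounded_of_pos [FiniteDimensional ℝ E] (B : E →L[ℝ] E →L[ℝ] ℝ)
    (hB : ∀ v, v ≠ 0 → 0 < B v v) : Bornology.IsVonNBounded ℝ {v | B v v < 1} := by
  rw [NormedSpace.isVonNBounded_iff ℝ, isBounded_iff_forall_norm_le]
  obtain hE | hE := subsingleton_or_nontrivial E
  · exact ⟨0, fun v _ => by simp [Subsingleton.elim v 0]⟩
  have hcont : Continuous fun v : E => B v v := by fun_prop
  obtain ⟨w, hw, hmin⟩ := (isCompact_sphere (0 : E) 1).exists_isMinOn
    (NormedSpace.sphere_nonempty.2 zero_le_one) hcont.continuousOn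
  have hw0 : w ≠ 0 := by
    rintro rfl
    simp at hw
  set m := B w w
  have hm : 0 < m := hB w hw0
  have hlow (v : E) : m * ‖v‖ ^ 2 ≤ B v v := by
    by_cases hv : v = 0
    · simp [hv]
    have hv' : ‖v‖ ≠ 0 := norm_ne_zero_iff.2 hv
    have h1 : m ≤ B (‖v‖⁻¹ • v) (‖v‖⁻¹ • v) := hmin (by
      simp [norm_smul, inv_mul_cancel₀ hv'])
    simp only [map_smul, smul_apply, smul_eq_mul] at h1
    calc m * ‖v‖ ^ 2 ≤ (‖v‖⁻¹ * (‖v‖⁻¹ * B v v)) * ‖v‖ ^ 2 := by gcongr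
      _ = B v v := by field_simp
  -- This bound avoids a square root: x² < s implies x ≤ x² + 1 < s + 1.
  refine ⟨m⁻¹ + 1, fun v hv => ?_⟩
  have h2 : m * ‖v‖ ^ 2 < 1 := (hlow v).trans_lt hv
  have h3 : ‖v‖ ^ 2 < m⁻¹ := by
    rw [← one_div, lt_div_iff₀ hm]
    linarith
  nlinarith [norm_nonneg v, inv_pos.2 hm]

/-- The almost contact metric structure on a manifold with a global chart whose tensor fields are
given in the chart by smooth functions. -/
def IsGlobalChart.almostContactMetricStructure [FiniteDimensional ℝ E]
    (g : E → E →L[ℝ] E →L[ℝ] ℝ) (ξ : E → E) (η : E → E →L[ℝ] ℝ) (φ : E → E →L[ℝ] E)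
    (hg : ContDiff ℝ ∞ g) (hξ : ContDiff ℝ ∞ ξ) (hη : ContDiff ℝ ∞ η) (hφ : ContDiff ℝ ∞ φ)
    (symm : ∀ t u v, g t u v = g t v u) (pos : ∀ t v, v ≠ 0 → 0 < g t v v)
    (η_ξ : ∀ t, η t (ξ t) = 1) (φ_φ : ∀ t u, φ t (φ t u) = -u + η t u • ξ t)
    (g_φ_φ : ∀ t u v, g t (φ t u) (φ t v) = g t u v - η t u * η t v) :
    AlmostContactMetricStructure 𝓘(ℝ, E) M where
  g :=
    { inner := fun x => g (e x)
      symm := fun x => symm (e x)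
      pos := fun x => pos (e x)
      isVonNBounded := fun x => isVonNBounded_of_pos (g (e x)) (pos (e x))
      contMDiff := he.contMDiff_bilinForm hg }
  ξ := fun x => ξ (e x)
  η := fun x => η (e x)
  φ := fun x => φ (e x)
  smooth_ξ := fun x => he.contMDiffAt_vectorField_iff.2 (by
    simpa using hξ.contDiffAt)
  smooth_η := he.contMDiff_covector hη
  smooth_φ := he.contMDiff_endomorphism hφ
  η_ξ := fun x => η_ξ (e x)
  φ_φ := fun x => φ_φ (e x)
  g_φ_φ := fun x => g_φ_φ (e x)

/-- By the product rule, the terms in which `η` is applied to derivatives of `X` and `Y` are exactly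
cancelled by `η` of the bracket. Only the antisymmetrized derivative of `η` remains. -/
theorem IsGlobalChart.extDerivOneForm_eq {η : E → E →L[ℝ] ℝ} (hη : ContDiff ℝ ∞ η)
    {X Y : ∀ x : M, TangentSpace 𝓘(ℝ, E) x} {x : M}
    (hX : ContMDiffAt 𝓘(ℝ, E) 𝓘(ℝ, E).tangent ∞
      (fun y => (⟨y, X y⟩ : TangentBundle 𝓘(ℝ, E) M)) x)
    (hY : ContMDiffAt 𝓘(ℝ, E) 𝓘(ℝ, E).tangent ∞
      (fun y => (⟨y, Y y⟩ : TangentBundle 𝓘(ℝ, E) M)) x) :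
    extDerivOneForm 𝓘(ℝ, E) (fun x => η (e x)) X Y x =
      (1 / 2) * (fderiv ℝ η (e x) (X x) (Y x) - fderiv ℝ η (e x) (Y x) (X x)) := by
  have hη' : DifferentiableAt ℝ η (e x) := (hη.differentiable (by simp)).differentiableAt
  -- The two values lie in formally different tangent spaces, both equal to `E`; generalizing the
  -- point allows the comparison.
  have hval (V : ∀ x : M, TangentSpace 𝓘(ℝ, E) x) : (V (e.symm (e x)) : E) = (V x : E) := by
    generalize hy : e.symm (e x) = y
    obtain rfl : y = x := by rw [← hy, e.symm_apply_apply]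
    rfl
  have key (V : ∀ x : M, TangentSpace 𝓘(ℝ, E) x) (v : E)
      (hV : ContMDiffAt 𝓘(ℝ, E) 𝓘(ℝ, E).tangent ∞
        (fun y => (⟨y, V y⟩ : TangentBundle 𝓘(ℝ, E) M)) x) :
      differential 𝓘(ℝ, E) (fun y => η (e y) (V y)) x v =
        fderiv ℝ η (e x) v (V x) + η (e x) (fderiv ℝ (fun t => (V (e.symm t) : E)) (e x) v) := by
    have hV' : DifferentiableAt ℝ (fun t => (V (e.symm t) : E)) (e x) :=
      (he.contMDiffAt_vectorField_iff.1 hV).differentiableAt (by simp)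
    have hcomp : ((fun y => η (e y) (V y)) ∘ e.symm) =
        fun t => η t ((fun t => (V (e.symm t) : E)) t) := by
      funext t
      simp only [Function.comp_def, Homeomorph.apply_symm_apply]
    have h := hη'.hasFDerivAt.clm_apply hV'.hasFDerivAt
    rw [← hcomp] at h
    have h' := (he.differential_eq h.differentiableAt).trans h.fderiv
    exact (congrArg (fun L : E →L[ℝ] ℝ => L v) h').trans ((add_comm
      (η (e x) (fderiv ℝ (fun t => (V (e.symm t) : E)) (e x) v))
      (fderiv ℝ η (e x) v (V (e.symm (e x))))).trans
      (congrArg (fun z : E => fderiv ℝ η (e x) v z + _) (hval V)))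
  have hb := he.mlieBracket_eq X Y x
  have h1 := key Y (X x) hY
  have h2 := key X (Y x) hX
  have h3 : η (e x) (VectorField.mlieBracket 𝓘(ℝ, E) X Y x) =
      η (e x) (fderiv ℝ (fun t => (Y (e.symm t) : E)) (e x) (X x)) -
        η (e x) (fderiv ℝ (fun t => (X (e.symm t) : E)) (e x) (Y x)) := by
    refine (congrArg (η (e x)) hb).trans ?_
    refine (map_sub (η (e x)) _ _).trans ?_
    exact congrArg₂ (fun a b : E => η (e x) (fderiv ℝ (fun t => (Y (e.symm t) : E)) (e x) a) -
      η (e x) (fderiv ℝ (fun t => (X (e.symm t) : E)) (e x) b)) (hval X) (hval Y)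
  refine (congrArg (fun r : ℝ => 1 / 2 * r)
    (congrArg₂ (· - ·) (congrArg₂ (· - ·) h1 h2) h3)).trans ?_
  ring

end Bundle
end ConstantChart

open Matrix

/-! ### Vectors and block matrices -/

section LinearAlgebra

variable {n : ℕ}

/-- The vector of `ℝ^{n+3}` with the given coordinates. -/
def vec (a b c d : ℝ) (f : Fin (n - 1) → ℝ) : Idx n → ℝ :=
  Sum.elim ![a, b] (Sum.elim ![c, d] f)

theorem exists_eq_vec (x : Idx n → ℝ) : ∃ a b c d f, x = vec a b c d f := by
  refine ⟨x (.inl 0), x (.inl 1), x (.inr (.inl 0)), x (.inr (.inl 1)),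
    fun i => x (.inr (.inr i)), ?_⟩
  ext (i | i | i)
  · fin_cases i <;> rfl
  · fin_cases i <;> rfl
  · rfl

theorem vec_eq_vec_iff {a b c d a' b' c' d' : ℝ} {f f' : Fin (n - 1) → ℝ} :
    (vec a b c d f : Idx n → ℝ) = vec a' b' c' d' f' ↔
      a = a' ∧ b = b' ∧ c = c' ∧ d = d' ∧ f = f' := by
  refine ⟨fun h => ⟨congrFun h (.inl 0), congrFun h (.inl 1), congrFun h (.inr (.inl 0)),
    congrFun h (.inr (.inl 1)), funext fun i => congrFun h (.inr (.inr i))⟩, ?_⟩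
  rintro ⟨rfl, rfl, rfl, rfl, rfl⟩
  rfl

theorem vec_add (a b c d a' b' c' d' : ℝ) (f f' : Fin (n - 1) → ℝ) :
    (vec a b c d f : Idx n → ℝ) + vec a' b' c' d' f' =
      vec (a + a') (b + b') (c + c') (d + d') (f + f') := by
  ext (i | i | i)
  · fin_cases i <;> rfl
  · fin_cases i <;> rfl
  · rfl

theorem smul_vec (r a b c d : ℝ) (f : Fin (n - 1) → ℝ) :
    r • (vec a b c d f : Idx n → ℝ) = vec (r * a) (r * b) (r * c) (r * d) (r • f) := by
  ext (i | i | i)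
  · fin_cases i <;> rfl
  · fin_cases i <;> rfl
  · rfl

theorem vec_zero : (vec 0 0 0 0 0 : Idx n → ℝ) = 0 := by
  ext (i | i | i)
  · fin_cases i <;> rfl
  · fin_cases i <;> rfl
  · rfl

theorem block_mulVec (p q r s : Matrix (Fin 2) (Fin 2) ℝ) (a b c d : ℝ) (f : Fin (n - 1) → ℝ) :
    block n p q r s *ᵥ vec a b c d f =
      vec (p 0 0 * a + p 0 1 * b + (q 0 0 * c + q 0 1 * d))
        (p 1 0 * a + p 1 1 * b + (q 1 0 * c + q 1 1 * d))
        (r 0 0 * a + r 0 1 * b + (s 0 0 * c + s 0 1 * d))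
        (r 1 0 * a + r 1 1 * b + (s 1 0 * c + s 1 1 * d)) 0 := by
  ext (i | i | i)
  · fin_cases i <;> simp [block, vec, mulVec, dotProduct, Fin.sum_univ_two]
  · fin_cases i <;> simp [block, vec, mulVec, dotProduct, Fin.sum_univ_two]
  · simp [block, vec, mulVec, dotProduct]

theorem block_mul (p q r s p' q' r' s' : Matrix (Fin 2) (Fin 2) ℝ) :
    block n p q r s * block n p' q' r' s' =
      block n (p * p' + q * r') (p * q' + q * s') (r * p' + s * r') (r * q' + s * s') := by
  rw [block, block, fromBlocks_multiply]
  ext (i | i | i) (j | j | j) <;> simp [block, fromBlocks, mul_apply, Fin.sum_univ_two]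

theorem block_sub (p q r s p' q' r' s' : Matrix (Fin 2) (Fin 2) ℝ) :
    block n p q r s - block n p' q' r' s' = block n (p - p') (q - q') (r - r') (s - s') := by
  ext (i | i | i) (j | j | j) <;> simp [block]

theorem smul_block (t : ℝ) (p q r s : Matrix (Fin 2) (Fin 2) ℝ) :
    t • block n p q r s = block n (t • p) (t • q) (t • r) (t • s) := by
  ext (i | i | i) (j | j | j) <;> simp [block]

theorem shortRoot_mulVec (k : Fin 2) (i : Fin (n - 1)) (a b c d : ℝ) (f : Fin (n - 1) → ℝ) :
    shortRoot n k i *ᵥ vec a b c d f =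
      (2 : ℝ) • vec (if k = 0 then f i else 0) (if k = 1 then f i else 0)
        (if k = 0 then f i else 0) (if k = 1 then f i else 0)
        (Pi.single i (if k = 0 then a - c else b - d)) := by
  have h2 : c₀ / √2 = 2 := by
    rw [c₀, mul_div_assoc, div_self (by positivity), mul_one]
  rw [shortRoot, h2, smul_mulVec]
  congr 1
  ext (j | j | j)
  · fin_cases j <;> fin_cases k <;>
      simp [vec, mulVec, dotProduct, Matrix.single, Finset.sum_ite_eq]
  · fin_cases j <;> fin_cases k <;>
      simp [vec, mulVec, dotProduct, Matrix.single, Finset.sum_ite_eq]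
  · obtain rfl | hij := eq_or_ne i j
    · fin_cases k <;> simp [vec, mulVec, dotProduct, Matrix.single, sub_eq_add_neg]
    · fin_cases k <;> simp [vec, mulVec, dotProduct, Matrix.single, hij, hij.symm]

/-- Matrix identities below are checked on a general coordinate vector, which keeps the last block
of size n - 1 in one piece. -/
theorem mat_ext_mulVec {X Y : Mat n}
    (h : ∀ a b c d f, X *ᵥ vec a b c d f = Y *ᵥ vec a b c d f) : X = Y := by
  refine ext_of_mulVec_single fun i => ?_
  obtain ⟨a, b, c, d, f, hv⟩ := exists_eq_vec (Pi.single i 1 : Idx n → ℝ)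
  rw [hv, h]

end LinearAlgebra


/-! ### The Lie algebra `𝔰_N` in coordinates -/

theorem c₀_pos : 0 < c₀ := by unfold c₀; positivity

theorem c₀_sq : c₀ ^ 2 = 8 := by
  rw [c₀, mul_pow, Real.sq_sqrt (by norm_num)]; norm_num

section Algebra

variable {n : ℕ}

/-- The coordinate space of the group `S_N` and of its orbits. -/
abbrev Param (n : ℕ) : Type :=
  ℝ × (Fin (n - 1) → ℝ) × ℝ × ℝ × (Fin (n - 1) → ℝ)

/-- The linear parametrization of the Lie algebra `𝔰_N`. -/
def sNMat (n : ℕ) : Param n →ₗ[ℝ] Mat n where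
  -- The coefficients are chosen so that (r, y, k₂, k₄, k) sends e₁ to (0, k₂, 0, k₄, k) and e₂ to
  -- (-k₂, 0, -k₂, r, y). The parameters are thus the velocities at o of the entries of a e₁ and a
  -- e₂ that will serve as coordinates of the orbit.
  toFun t := (-t.1 / c₀) • (A₁ n - A₂ n) + ((t.2.2.2.1 - t.2.2.1) / c₀) • X₀ n +
    ((t.2.2.1 + t.2.2.2.1) / c₀) • W₀ n + ∑ i, (t.2.1 i / 2) • shortRoot n 1 i +
    ∑ i, (t.2.2.2.2 i / 2) • shortRoot n 0 i
  map_add' s t := by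
    simp only [Prod.fst_add, Prod.snd_add, Pi.add_apply, add_div, add_smul, sub_div, sub_smul,
      neg_add, Finset.sum_add_distrib]
    abel
  map_smul' r t := by
    simp only [Prod.smul_fst, Prod.smul_snd, Pi.smul_apply, smul_eq_mul, RingHom.id_apply,
      smul_add, Finset.smul_sum, smul_smul, ← mul_neg, ← mul_sub, ← mul_add, mul_div_assoc]

theorem sNMat_apply (t : Param n) : sNMat n t =
    (-t.1 / c₀) • (A₁ n - A₂ n) + ((t.2.2.2.1 - t.2.2.1) / c₀) • X₀ n +
    ((t.2.2.1 + t.2.2.2.1) / c₀) • W₀ n + ∑ i, (t.2.1 i / 2) • shortRoot n 1 i +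
    ∑ i, (t.2.2.2.2 i / 2) • shortRoot n 0 i := rfl

theorem sum_smul_shortRoot_one_mulVec (y : Fin (n - 1) → ℝ) (a b c d : ℝ) (f : Fin (n - 1) → ℝ) :
    (∑ i, (y i / 2) • shortRoot n 1 i) *ᵥ vec a b c d f =
      vec 0 (y ⬝ᵥ f) 0 (y ⬝ᵥ f) ((b - d) • y) := by
  rw [sum_mulVec]
  simp only [smul_mulVec, shortRoot_mulVec, smul_smul]
  ext (j | j | j)
  · fin_cases j <;> simp [vec, dotProduct, Finset.sum_apply]
  · fin_cases j <;> simp [vec, dotProduct, Finset.sum_apply]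
  · simp [vec, Finset.sum_apply, Pi.single_apply]
    ring

theorem sum_smul_shortRoot_zero_mulVec (y : Fin (n - 1) → ℝ) (a b c d : ℝ)
    (f : Fin (n - 1) → ℝ) :
    (∑ i, (y i / 2) • shortRoot n 0 i) *ᵥ vec a b c d f =
      vec (y ⬝ᵥ f) 0 (y ⬝ᵥ f) 0 ((a - c) • y) := by
  rw [sum_mulVec]
  simp only [smul_mulVec, shortRoot_mulVec, smul_smul]
  ext (j | j | j)
  · fin_cases j <;> simp [vec, dotProduct, Finset.sum_apply]
  · fin_cases j <;> simp [vec, dotProduct, Finset.sum_apply]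
  · simp [vec, Finset.sum_apply, Pi.single_apply]
    ring

theorem sNMat_mulVec (r k₂ k₄ : ℝ) (y k : Fin (n - 1) → ℝ) (a b c d : ℝ) (f : Fin (n - 1) → ℝ) :
    sNMat n (r, y, k₂, k₄, k) *ᵥ vec a b c d f =
      vec (-k₂ * b + k₄ * d + k ⬝ᵥ f) (r * d + (a - c) * k₂ + y ⬝ᵥ f)
        (-k₂ * b + k₄ * d + k ⬝ᵥ f) (r * b + (a - c) * k₄ + y ⬝ᵥ f)
        ((a - c) • k + (b - d) • y) := by
  have hc := c₀_pos.ne'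
  rw [sNMat_apply]
  simp only [add_mulVec, sum_smul_shortRoot_one_mulVec, sum_smul_shortRoot_zero_mulVec,
    A₁, A₂, X₀, W₀, ← smul_sub, block_sub, block_mulVec, U, V, vec_add, smul_block]
  simp only [vec_eq_vec_iff]
  refine ⟨?_, ?_, ?_, ?_, ?_⟩ <;> simp <;> first | (field_simp; ring) | skip
  abel

theorem N_eq : N n = block n 0 !![-2, 0; 0, 0] !![-2, 0; 0, 0] 0 := by
  have h2 : √2 * √2 = 2 := Real.mul_self_sqrt (by norm_num)
  have h3 : √2 ≠ 0 := by positivity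
  have h4 : (√2)⁻¹ * c₀ = 2 := by rw [c₀]; field_simp
  rw [N, A₁, A₂, ← smul_neg, ← smul_sub, smul_smul, ← neg_one_smul ℝ (block n _ _ _ _), smul_block,
    block_sub, smul_block]
  congr 1 <;> ext i j <;> fin_cases i <;> fin_cases j <;> simp <;> linarith

theorem velocity_N : velocity (N n) (Z n) = block n 0 !![0, 0; -2, 0] !![0, -2; 0, 0] 0 := by
  rw [velocity, N_eq, Z, block_mul, block_mul, block_sub]
  congr 1 <;> ext i j <;> fin_cases i <;> fin_cases j <;> simp [U]

/-- `N` lies in 𝔭, where ad Z squares to -1, so [Z, [N, Z]] = N. -/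
theorem J_velocity_N : J (Z n) (velocity (N n) (Z n)) = N n := by
  rw [J, velocity_N, N_eq, Z, block_mul, block_mul, block_sub]
  congr 1 <;> ext i j <;> fin_cases i <;> fin_cases j <;> simp [U]

/-- Invariance of the trace form moves the bracket with `p` to the other factor. Together with
`J_velocity_N` it turns the inner product with `N` into the trace against `N`. -/
theorem trace_velocity_mul (X p Y : Mat n) :
    trace (velocity X p * Y) = trace (X * J p Y) := by
  rw [velocity, J, sub_mul, mul_sub, trace_sub, trace_sub, mul_assoc, mul_assoc p X Y,
    trace_mul_comm p, mul_assoc X Y p]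

theorem trace_mul_N (X : Mat n) : trace (X * N n) = -2 *
    ((X *ᵥ vec 0 0 1 0 0) (.inl 0) + (X *ᵥ vec 1 0 0 0 0) (.inr (.inl 0))) := by
  rw [N_eq]
  simp [trace, mul_apply, block, Fintype.sum_sum_type, Fin.sum_univ_two, mulVec, dotProduct, vec]
  ring

theorem modelInner_N (X : Mat n) :
    modelInner X (N n) = -(1 / 4) *
      ((X *ᵥ vec 0 0 1 0 0) (.inl 0) + (X *ᵥ vec 1 0 0 0 0) (.inr (.inl 0))) := by
  rw [modelInner, metric, trace_velocity_mul, J_velocity_N, trace_mul_N, c₀_sq]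
  ring

theorem modelInner_sNMat_N (t : Param n) : modelInner (sNMat n t) (N n) = 0 := by
  obtain ⟨r, y, k₂, k₄, k⟩ := t
  rw [modelInner_N, sNMat_mulVec, sNMat_mulVec]
  simp [vec]

theorem modelInner_N_N : modelInner (N n) (N n) = 1 := by
  rw [modelInner_N, N_eq, block_mulVec, block_mulVec]
  simp [vec]
  norm_num

theorem modelInner_add_smul (X Y W : Mat n) (r : ℝ) :
    modelInner (X + r • Y) W = modelInner X W + r * modelInner Y W := by
  simp only [modelInner, metric, velocity, add_mul, mul_add, smul_mul_assoc, mul_smul_comm,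
    sub_mul, trace_add, trace_sub, trace_smul, smul_eq_mul]
  ring

theorem sNMat_mem_solvablePart (t : Param n) : sNMat n t ∈ solvablePart n := by
  have hA₁ : A₁ n ∈ solvablePart n := Submodule.subset_span (by simp)
  have hA₂ : A₂ n ∈ solvablePart n := Submodule.subset_span (by simp)
  have hX : X₀ n ∈ solvablePart n := Submodule.subset_span (by simp)
  have hW : W₀ n ∈ solvablePart n := Submodule.subset_span (by simp)
  have h0 (i) : shortRoot n 0 i ∈ solvablePart n := Submodule.subset_span (by simp)
  have h1 (i) : shortRoot n 1 i ∈ solvablePart n := Submodule.subset_span (by simp)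
  rw [sNMat_apply]
  refine add_mem (add_mem (add_mem (add_mem ?_ ?_) ?_) (sum_mem fun i _ => ?_))
    (sum_mem fun i _ => ?_)
  · exact Submodule.smul_mem _ _ (sub_mem hA₁ hA₂)
  · exact Submodule.smul_mem _ _ hX
  · exact Submodule.smul_mem _ _ hW
  · exact Submodule.smul_mem _ _ (h1 i)
  · exact Submodule.smul_mem _ _ (h0 i)

theorem exists_of_mem_solvablePart {X : Mat n} (hX : X ∈ solvablePart n) :
    ∃ (t : Param n) (r : ℝ), X = sNMat n t + r • N n := by
  have hle : solvablePart n ≤ LinearMap.range (sNMat n) ⊔ Submodule.span ℝ {N n} := by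
    have key (t : Param n) (r : ℝ) :
        sNMat n t + r • N n ∈ LinearMap.range (sNMat n) ⊔ Submodule.span ℝ {N n} :=
      Submodule.add_mem_sup (LinearMap.mem_range_self _ t)
        (Submodule.smul_mem _ r (Submodule.mem_span_singleton_self _))
    refine Submodule.span_le.2 ?_
    rintro X ((hX | ⟨i, rfl⟩) | ⟨i, rfl⟩)
    · simp only [Set.mem_insert_iff, Set.mem_singleton_iff] at hX
      obtain rfl | rfl | rfl | rfl := hX
      -- A₁ = (A₁ - A₂)/2 + (A₁ + A₂)/2, and the second summand is -(c₀/4) N because c₀ = 2√2. For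
      -- A₂ only the sign of the first summand changes.
      · convert! key (-c₀ / 2, 0, 0, 0, 0) (-c₀ / 4) using 1
        refine mat_ext_mulVec fun a b c d f => ?_
        rw [add_mulVec, smul_mulVec, sNMat_mulVec, N_eq, block_mulVec, smul_vec, vec_add, A₁,
          smul_mulVec, block_mulVec, smul_vec, vec_eq_vec_iff]
        refine ⟨?_, ?_, ?_, ?_, ?_⟩ <;> simp <;> ring
      · convert! key (c₀ / 2, 0, 0, 0, 0) (-c₀ / 4) using 1
        refine mat_ext_mulVec fun a b c d f => ?_
        rw [add_mulVec, smul_mulVec, sNMat_mulVec, N_eq, block_mulVec, smul_vec, vec_add, A₂,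
          smul_mulVec, block_mulVec, smul_vec, vec_eq_vec_iff]
        refine ⟨?_, ?_, ?_, ?_, ?_⟩ <;> simp <;> ring
      · convert! key (0, 0, -c₀ / 2, c₀ / 2, 0) 0 using 1
        refine mat_ext_mulVec fun a b c d f => ?_
        rw [add_mulVec, smul_mulVec, sNMat_mulVec, N_eq, block_mulVec, smul_vec, vec_add, X₀,
          smul_mulVec, block_mulVec, smul_vec, vec_eq_vec_iff]
        refine ⟨?_, ?_, ?_, ?_, ?_⟩ <;> simp [U, V] <;> ring
      · convert! key (0, 0, c₀ / 2, c₀ / 2, 0) 0 using 1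
        refine mat_ext_mulVec fun a b c d f => ?_
        rw [add_mulVec, smul_mulVec, sNMat_mulVec, N_eq, block_mulVec, smul_vec, vec_add, W₀,
          smul_mulVec, block_mulVec, smul_vec, vec_eq_vec_iff]
        refine ⟨?_, ?_, ?_, ?_, ?_⟩ <;> simp [U] <;> ring
    · convert! key (0, 0, 0, 0, Pi.single i 2) 0 using 1
      refine mat_ext_mulVec fun a b c d f => ?_
      rw [add_mulVec, smul_mulVec, sNMat_mulVec, N_eq, block_mulVec, smul_vec, vec_add,
        shortRoot_mulVec, smul_vec, vec_eq_vec_iff]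
      refine ⟨?_, ?_, ?_, ?_, ?_⟩ <;> simp [← Pi.single_smul, mul_comm]
    · convert! key (0, Pi.single i 2, 0, 0, 0) 0 using 1
      refine mat_ext_mulVec fun a b c d f => ?_
      rw [add_mulVec, smul_mulVec, sNMat_mulVec, N_eq, block_mulVec, smul_vec, vec_add,
        shortRoot_mulVec, smul_vec, vec_eq_vec_iff]
      refine ⟨?_, ?_, ?_, ?_, ?_⟩ <;> simp [← Pi.single_smul, mul_comm]
  obtain ⟨_, ⟨t, rfl⟩, z, hz, rfl⟩ := Submodule.mem_sup.1 (hle hX)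
  obtain ⟨r, rfl⟩ := Submodule.mem_span_singleton.1 hz
  exact ⟨t, r, rfl⟩

/-- Every element of 𝔰 is some `sNMat n t` plus a multiple of `N`. As `N` is a unit vector
orthogonal to the first summand, orthogonality to `N` kills the multiple. -/
theorem mem_sN_iff {X : Mat n} : X ∈ sN n ↔ ∃ t, X = sNMat n t := by
  constructor
  · rintro ⟨hX, hX'⟩
    obtain ⟨t, r, rfl⟩ := exists_of_mem_solvablePart hX
    rw [modelInner_add_smul, modelInner_sNMat_N, modelInner_N_N, zero_add, mul_one] at hX'
    exact ⟨t, by rw [hX', zero_smul, add_zero]⟩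
  · rintro ⟨t, rfl⟩
    exact ⟨sNMat_mem_solvablePart t, modelInner_sNMat_N t⟩

end Algebra

/-! ### The bilinear form and its isometries -/

section Form

variable {n : ℕ}

/-- The diagonal matrix with entries `1, 1, -1, …, -1`. -/
abbrev formMat (n : ℕ) : Mat n :=
  LieAlgebra.Orthogonal.indefiniteDiagonal (Fin 2) (Fin 2 ⊕ Fin (n - 1)) ℝ

/-- The symmetric bilinear form of signature `(2, n + 1)`. -/
def form (x y : Idx n → ℝ) : ℝ := x ⬝ᵥ (formMat n *ᵥ y)

theorem formMat_mulVec_vec (a b c d : ℝ) (f : Fin (n - 1) → ℝ) :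
    formMat n *ᵥ vec a b c d f = vec a b (-c) (-d) (-f) := by
  ext (i | i | i)
  · fin_cases i <;> simp [LieAlgebra.Orthogonal.indefiniteDiagonal, mulVec_diagonal, vec]
  · fin_cases i <;> simp [LieAlgebra.Orthogonal.indefiniteDiagonal, mulVec_diagonal, vec]
  · simp [LieAlgebra.Orthogonal.indefiniteDiagonal, mulVec_diagonal, vec]

theorem vec_dotProduct_vec (a b c d a' b' c' d' : ℝ) (f f' : Fin (n - 1) → ℝ) :
    (vec a b c d f : Idx n → ℝ) ⬝ᵥ vec a' b' c' d' f' =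
      a * a' + b * b' + c * c' + d * d' + f ⬝ᵥ f' := by
  simp [dotProduct, vec, Fintype.sum_sum_type, Fin.sum_univ_two]
  ring

theorem form_vec (a b c d a' b' c' d' : ℝ) (f f' : Fin (n - 1) → ℝ) :
    form (vec a b c d f : Idx n → ℝ) (vec a' b' c' d' f') =
      a * a' + b * b' - c * c' - d * d' - f ⬝ᵥ f' := by
  rw [form, formMat_mulVec_vec, vec_dotProduct_vec, dotProduct_neg]
  ring

theorem form_comm (x y : Idx n → ℝ) : form x y = form y x := by
  obtain ⟨a, b, c, d, f, rfl⟩ := exists_eq_vec x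
  obtain ⟨a', b', c', d', f', rfl⟩ := exists_eq_vec y
  rw [form_vec, form_vec, dotProduct_comm]
  ring

theorem formMat_mul_self : formMat n * formMat n = 1 := by
  refine mat_ext_mulVec fun a b c d f => ?_
  rw [← mulVec_mulVec, formMat_mulVec_vec, formMat_mulVec_vec, one_mulVec]
  simp

theorem formMat_transpose : (formMat n)ᵀ = formMat n := by
  simp [LieAlgebra.Orthogonal.indefiniteDiagonal]

theorem mem_so_iff {X : Mat n} : X ∈ so n ↔ Xᵀ * formMat n = -(formMat n * X) := by
  rw [so, mem_skewAdjointMatricesSubmodule, Matrix.IsSkewAdjoint, Matrix.IsAdjointPair, mul_neg]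

theorem form_mulVec_left (X : Mat n) (x y : Idx n → ℝ) :
    form (X *ᵥ x) y = x ⬝ᵥ ((Xᵀ * formMat n) *ᵥ y) := by
  rw [form, ← mulVec_mulVec, dotProduct_mulVec x, vecMul_transpose]

theorem form_mulVec_right (X : Mat n) (x y : Idx n → ℝ) :
    form x (X *ᵥ y) = x ⬝ᵥ ((formMat n * X) *ᵥ y) := by
  rw [form, mulVec_mulVec]

theorem form_mulVec_of_mem_so {X : Mat n} (hX : X ∈ so n) (x y : Idx n → ℝ) :
    form (X *ᵥ x) y = -form x (X *ᵥ y) := by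
  rw [form_mulVec_left, form_mulVec_right, mem_so_iff.1 hX, neg_mulVec, dotProduct_neg]

theorem mem_so_of_form {X : Mat n} (h : ∀ x y, form (X *ᵥ x) y = -form x (X *ᵥ y)) :
    X ∈ so n := by
  refine mem_so_iff.2 (ext_of_mulVec_single fun j => dotProduct_eq _ _ fun x => ?_)
  rw [dotProduct_comm, dotProduct_comm _ x, ← form_mulVec_left, h, form_mulVec_right, neg_mulVec,
    dotProduct_neg]

theorem sNMat_mem_so (t : Param n) : sNMat n t ∈ so n := by
  obtain ⟨r, y, k₂, k₄, k⟩ := t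
  refine mem_so_of_form fun v w => ?_
  obtain ⟨a, b, c, d, f, rfl⟩ := exists_eq_vec v
  obtain ⟨a', b', c', d', f', rfl⟩ := exists_eq_vec w
  rw [sNMat_mulVec, sNMat_mulVec, form_vec, form_vec]
  simp only [add_dotProduct, smul_dotProduct, smul_eq_mul, dotProduct_comm f]
  ring

/-- `a` preserves the bilinear form of signature `(2, n + 1)`. -/
def IsIsometry (a : Mat n) : Prop := aᵀ * formMat n * a = formMat n

theorem IsIsometry.form_mulVec {a : Mat n} (ha : IsIsometry a) (x y : Idx n → ℝ) :
    form (a *ᵥ x) (a *ᵥ y) = form x y := by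
  rw [form_mulVec_left, mulVec_mulVec, ha, form]

theorem IsIsometry.mul {a b : Mat n} (ha : IsIsometry a) (hb : IsIsometry b) :
    IsIsometry (a * b) := by
  unfold IsIsometry at *
  rw [transpose_mul, mul_assoc, mul_assoc, ← mul_assoc (formMat n), ← mul_assoc aᵀ,
    ← mul_assoc aᵀ, ha, ← mul_assoc, hb]

theorem isIsometry_one : IsIsometry (1 : Mat n) := by
  simp [IsIsometry]

theorem IsIsometry.formMat_mul_inv {a : GL (Idx n) ℝ} (ha : IsIsometry (a : Mat n)) :
    formMat n * ((a⁻¹ : GL (Idx n) ℝ) : Mat n) = (a : Mat n)ᵀ * formMat n := by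
  conv_lhs => rw [← ha]
  rw [mul_assoc, Units.mul_inv, mul_one]

theorem IsIsometry.inv {a : GL (Idx n) ℝ} (ha : IsIsometry (a : Mat n)) :
    IsIsometry ((a⁻¹ : GL (Idx n) ℝ) : Mat n) := by
  unfold IsIsometry
  rw [mul_assoc, ha.formMat_mul_inv, ← mul_assoc, ← transpose_mul, Units.mul_inv, transpose_one,
    one_mul]

/-- Skew-adjointness says that Xᵀ is the conjugate of -X by the form matrix, so exp(X)ᵀ is the
conjugate of exp(-X) = exp(X)⁻¹. -/
theorem isIsometry_exp {X : Mat n} (hX : X ∈ so n) : IsIsometry (NormedSpace.exp X) := by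
  have hB : IsUnit (formMat n) := IsUnit.of_mul_eq_one _ formMat_mul_self
  have hinv : (formMat n)⁻¹ = formMat n := inv_eq_right_inv formMat_mul_self
  have h1 : Xᵀ = formMat n * (-X) * (formMat n)⁻¹ := by
    rw [mul_neg, ← mem_so_iff.1 hX, mul_assoc, mul_nonsing_inv _ (by
      simpa [Matrix.isUnit_iff_isUnit_det] using hB), mul_one]
  rw [IsIsometry, ← exp_transpose, h1, exp_conj _ _ hB, hinv, mul_assoc, mul_assoc,
    ← mul_assoc (formMat n) (formMat n), formMat_mul_self, one_mul, exp_neg,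
    mul_assoc, nonsing_inv_mul, mul_one]
  exact (Matrix.isUnit_iff_isUnit_det _).1 (isUnit_exp X)

/-! ### Exponentials -/

theorem hasSum_exp_mulVec (X : Mat n) (v : Idx n → ℝ) :
    HasSum (fun k : ℕ => ((k.factorial : ℝ)⁻¹) • ((X ^ k) *ᵥ v)) (NormedSpace.exp X *ᵥ v) := by
  have h := NormedSpace.exp_series_hasSum_exp' (𝕂 := ℝ) X
  have h' := h.map (mulVec.addMonoidHomLeft v) (by
    change Continuous fun A : Mat n => A *ᵥ v
    exact continuous_id.matrix_mulVec continuous_const)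
  convert! h' using 2 with k
  exact (smul_mulVec _ _ _).symm

/-- Modulo the invariant subspace `W`, `v` is an eigenvector of `X`, hence of every power of `X`.
The exponential series inherits this because `W` is closed. -/
theorem exp_mulVec_sub_mem {X : Mat n} {W : Submodule ℝ (Idx n → ℝ)}
    (hW : ∀ w ∈ W, X *ᵥ w ∈ W) {v : Idx n → ℝ} {ρ : ℝ} (hv : X *ᵥ v - ρ • v ∈ W) :
    NormedSpace.exp X *ᵥ v - Real.exp ρ • v ∈ W := by
  have h1 (k : ℕ) : (X ^ k) *ᵥ v - ρ ^ k • v ∈ W := by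
    induction k with
    | zero => simp
    | succ k ih =>
      have : (X ^ (k + 1)) *ᵥ v - ρ ^ (k + 1) • v =
          X *ᵥ ((X ^ k) *ᵥ v - ρ ^ k • v) + ρ ^ k • (X *ᵥ v - ρ • v) := by
        rw [pow_succ', ← mulVec_mulVec, mulVec_sub, mulVec_smul, smul_sub, smul_smul, pow_succ]
        abel
      rw [this]
      exact W.add_mem (hW _ ih) (W.smul_mem _ hv)
  have h2 : HasSum (fun k : ℕ => ((k.factorial : ℝ)⁻¹) • ((X ^ k) *ᵥ v - ρ ^ k • v))
      (NormedSpace.exp X *ᵥ v - Real.exp ρ • v) := by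
    have h3 := (NormedSpace.expSeries_div_hasSum_exp ρ).smul_const v
    rw [← Real.exp_eq_exp_ℝ] at h3
    convert! (hasSum_exp_mulVec X v).sub h3 using 2 with k
    rw [smul_sub, smul_smul, div_eq_inv_mul]
  exact (Submodule.closed_of_finiteDimensional W).mem_of_tendsto h2
    (Filter.Eventually.of_forall fun s => W.sum_mem fun k _ => W.smul_mem _ (h1 k))

theorem exp_mulVec_of_eigenvector {X : Mat n} {v : Idx n → ℝ} {ρ : ℝ} (hv : X *ᵥ v = ρ • v) :
    NormedSpace.exp X *ᵥ v = Real.exp ρ • v := by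
  have h := exp_mulVec_sub_mem (X := X) (W := ⊥) (v := v) (ρ := ρ) (by simp) (by simp [hv])
  simpa [sub_eq_zero] using h

/-- Evaluates the unipotent factors of `groupElement`: the series stops after the quadratic term. -/
theorem exp_mulVec_of_cube {X : Mat n} {v : Idx n → ℝ} (hv : X *ᵥ (X *ᵥ (X *ᵥ v)) = 0) :
    NormedSpace.exp X *ᵥ v = v + X *ᵥ v + (1 / 2 : ℝ) • (X *ᵥ (X *ᵥ v)) := by
  have h0 : ∀ k ∉ Finset.range 3, ((k.factorial : ℝ)⁻¹) • ((X ^ k) *ᵥ v) = 0 := by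
    intro k hk
    obtain ⟨m, rfl⟩ := Nat.exists_eq_add_of_le' (not_lt.1 (fun h => hk (Finset.mem_range.2 h)))
    have h3 : (X ^ 3) *ᵥ v = 0 := by
      rw [← hv]
      simp [pow_succ, mul_assoc]
    rw [pow_add, ← mulVec_mulVec, h3, mulVec_zero, smul_zero]
  rw [(hasSum_exp_mulVec X v).unique (hasSum_sum_of_ne_finset_zero h0)]
  simp [Finset.sum_range_succ, pow_two]

end Form

/-! ### The group `S_N` -/

section Group

variable {n : ℕ}

/-- Isometries that fix the isotropic vector `e₁ + e₃`, act on `e₂ + e₄` as a positive scalar modulo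
`e₁ + e₃`, and act trivially on the last block modulo these two vectors. -/
structure PreservesFlag (a : Mat n) : Prop where
  isIsometry : IsIsometry a
  map_null : a *ᵥ vec 1 0 1 0 0 = vec 1 0 1 0 0
  map_scaled : ∃ l > 0, ∃ b, a *ᵥ vec 0 1 0 1 0 = vec b l b l 0
  map_last : ∀ f, ∃ b c, a *ᵥ vec 0 0 0 0 f = vec c b c b f

theorem vec_null_decomp (c b : ℝ) (f : Fin (n - 1) → ℝ) :
    (vec c b c b f : Idx n → ℝ) =
      c • vec 1 0 1 0 0 + b • vec 0 1 0 1 0 + vec 0 0 0 0 f := by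
  simp [smul_vec, vec_add]

theorem PreservesFlag.one : PreservesFlag (1 : Mat n) where
  isIsometry := isIsometry_one
  map_null := one_mulVec _
  map_scaled := ⟨1, one_pos, 0, one_mulVec _⟩
  map_last _ := ⟨0, 0, one_mulVec _⟩

theorem PreservesFlag.mul {a b : Mat n} (ha : PreservesFlag a) (hb : PreservesFlag b) :
    PreservesFlag (a * b) where
  isIsometry := ha.isIsometry.mul hb.isIsometry
  map_null := by rw [← mulVec_mulVec, hb.map_null, ha.map_null]
  map_scaled := by
    obtain ⟨l, hl, x, h⟩ := ha.map_scaled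
    obtain ⟨l', hl', x', h'⟩ := hb.map_scaled
    refine ⟨l * l', mul_pos hl hl', x' + l' * x, ?_⟩
    rw [← mulVec_mulVec, h', vec_null_decomp, vec_zero, add_zero, mulVec_add, mulVec_smul,
      mulVec_smul, ha.map_null, h, smul_vec, smul_vec, vec_add]
    simp [mul_comm]
  map_last f := by
    obtain ⟨l, hl, x, h⟩ := ha.map_scaled
    obtain ⟨y, z, h'⟩ := hb.map_last f
    obtain ⟨y', z', h''⟩ := ha.map_last f
    refine ⟨y * l + y', z + y * x + z', ?_⟩
    rw [← mulVec_mulVec, h', vec_null_decomp, mulVec_add, mulVec_add, mulVec_smul,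
      mulVec_smul, ha.map_null, h, h'', smul_vec, smul_vec, vec_add, vec_add]
    simp

theorem PreservesFlag.inv {a : GL (Idx n) ℝ} (ha : PreservesFlag (a : Mat n)) :
    PreservesFlag ((a⁻¹ : GL (Idx n) ℝ) : Mat n) := by
  have hinv (x : Idx n → ℝ) : ((a⁻¹ : GL (Idx n) ℝ) : Mat n) *ᵥ ((a : Mat n) *ᵥ x) = x := by
    rw [mulVec_mulVec, Units.inv_mul, one_mulVec]
  obtain ⟨l, hl, x, h⟩ := ha.map_scaled
  have hl' := hl.ne'
  have hnull : ((a⁻¹ : GL (Idx n) ℝ) : Mat n) *ᵥ vec 1 0 1 0 0 = vec 1 0 1 0 0 := by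
    conv_lhs => rw [← ha.map_null, hinv]
  have hscaled : ((a⁻¹ : GL (Idx n) ℝ) : Mat n) *ᵥ vec 0 1 0 1 0 =
      vec (-(l⁻¹ * x)) l⁻¹ (-(l⁻¹ * x)) l⁻¹ 0 := by
    have h1 : (vec 0 1 0 1 0 : Idx n → ℝ) =
        l⁻¹ • ((a : Mat n) *ᵥ vec 0 1 0 1 0) + (-(l⁻¹ * x)) • vec 1 0 1 0 0 := by
      rw [h, smul_vec, smul_vec, vec_add]
      simp [hl']
    conv_lhs => rw [h1, mulVec_add, mulVec_smul, mulVec_smul, hinv, hnull, smul_vec, smul_vec,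
      vec_add]
    simp
  refine ⟨ha.isIsometry.inv, hnull, ⟨l⁻¹, inv_pos.2 hl, _, hscaled⟩, fun f => ?_⟩
  obtain ⟨y, z, h'⟩ := ha.map_last f
  refine ⟨-(y * l⁻¹), -z + y * (l⁻¹ * x), ?_⟩
  have h1 : (vec 0 0 0 0 f : Idx n → ℝ) =
      (a : Mat n) *ᵥ vec 0 0 0 0 f + (-z) • vec 1 0 1 0 0 + (-y) • vec 0 1 0 1 0 := by
    rw [h', smul_vec, smul_vec, vec_add, vec_add]
    simp
  conv_lhs => rw [h1, mulVec_add, mulVec_add, mulVec_smul, mulVec_smul, hinv, hnull, hscaled,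
    smul_vec, smul_vec, vec_add, vec_add]
  simp

/-- The generator kills v = e₁ + e₃, multiplies e₂ + e₄ by r modulo v, and maps the last block into
the span of these two vectors. Each property exponentiates by `exp_mulVec_sub_mem`. -/
theorem PreservesFlag.exp_sNMat (t : Param n) :
    PreservesFlag (NormedSpace.exp (sNMat n t)) := by
  have hso := isIsometry_exp (sNMat_mem_so t)
  obtain ⟨r, y, k₂, k₄, k⟩ := t
  have hnull : sNMat n (r, y, k₂, k₄, k) *ᵥ vec 1 0 1 0 0 = 0 := by
    rw [sNMat_mulVec]; simp [vec_zero]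
  have hscaled : sNMat n (r, y, k₂, k₄, k) *ᵥ vec 0 1 0 1 0 =
      (k₄ - k₂) • vec 1 0 1 0 0 + r • vec 0 1 0 1 0 := by
    rw [sNMat_mulVec, smul_vec, smul_vec, vec_add]; simp [vec_eq_vec_iff]; ring
  refine ⟨hso, ?_, ⟨Real.exp r, Real.exp_pos r, ?_⟩, fun f => ?_⟩
  · have := exp_mulVec_of_eigenvector (ρ := 0) (hnull.trans (zero_smul ℝ _).symm)
    rwa [Real.exp_zero, one_smul] at this
  · have h := exp_mulVec_sub_mem (X := sNMat n (r, y, k₂, k₄, k)) (v := vec 0 1 0 1 0) (ρ := r)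
      (W := Submodule.span ℝ {vec 1 0 1 0 0}) (by
        intro w hw
        obtain ⟨x, rfl⟩ := Submodule.mem_span_singleton.1 hw
        rw [mulVec_smul, hnull, smul_zero]
        exact zero_mem _) (by
        rw [hscaled, add_sub_cancel_right]
        exact Submodule.smul_mem _ _ (Submodule.mem_span_singleton_self _))
    obtain ⟨x, hx⟩ := Submodule.mem_span_singleton.1 h
    refine ⟨x, ?_⟩
    rw [← sub_add_cancel (NormedSpace.exp _ *ᵥ _) (Real.exp r • vec 0 1 0 1 0), ← hx, smul_vec,
      smul_vec, vec_add]
    simp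
  · have h := exp_mulVec_sub_mem (X := sNMat n (r, y, k₂, k₄, k)) (v := vec 0 0 0 0 f) (ρ := 0)
      (W := Submodule.span ℝ {vec 1 0 1 0 0, vec 0 1 0 1 0}) (by
        intro w hw
        obtain ⟨x, z, rfl⟩ := Submodule.mem_span_pair.1 hw
        rw [mulVec_add, mulVec_smul, mulVec_smul, hnull, hscaled]
        refine Submodule.mem_span_pair.2 ⟨z * (k₄ - k₂), z * r, ?_⟩
        simp [smul_smul]) (by
        refine Submodule.mem_span_pair.2 ⟨k ⬝ᵥ f, y ⬝ᵥ f, ?_⟩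
        rw [sNMat_mulVec, zero_smul, sub_zero, smul_vec, smul_vec, vec_add]
        simp)
    obtain ⟨x, z, hx⟩ := Submodule.mem_span_pair.1 h
    refine ⟨z, x, ?_⟩
    rw [← sub_add_cancel (NormedSpace.exp _ *ᵥ _) (Real.exp 0 • vec 0 0 0 0 f), ← hx, smul_vec,
      smul_vec, smul_vec, vec_add, vec_add]
    simp

theorem preservesFlag_of_mem_SN {a : GL (Idx n) ℝ} (ha : a ∈ SN n) :
    PreservesFlag (a : Mat n) := by
  refine Subgroup.closure_induction (p := fun (a : GL (Idx n) ℝ) _ => PreservesFlag (a : Mat n))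
    ?_ ?_ ?_ ?_ ha
  · rintro a ⟨X, hX, h⟩
    obtain ⟨t, rfl⟩ := mem_sN_iff.1 hX
    rw [h]
    exact .exp_sNMat t
  · exact .one
  · intro a b _ _ ha hb
    exact ha.mul hb
  · intro a _ ha
    exact ha.inv

/-- The coefficients left open by the flag conditions are products of the image vectors with e₁ and
e₂. These two vectors are fixed, so invariance of the form gives the coefficients their values for
the identity. This is the freeness of the action of S_N on frames. -/
theorem PreservesFlag.eq_one {a : Mat n} (ha : PreservesFlag a)
    (h₁ : a *ᵥ vec 1 0 0 0 0 = vec 1 0 0 0 0) (h₂ : a *ᵥ vec 0 1 0 0 0 = vec 0 1 0 0 0) :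
    a = 1 := by
  have hscaled : a *ᵥ vec 0 1 0 1 0 = vec 0 1 0 1 0 := by
    obtain ⟨l, hl, x, h⟩ := ha.map_scaled
    have e₁ := ha.isIsometry.form_mulVec (vec 0 1 0 1 0) (vec 1 0 0 0 0)
    have e₂ := ha.isIsometry.form_mulVec (vec 0 1 0 1 0) (vec 0 1 0 0 0)
    rw [h₁, h, form_vec, form_vec] at e₁
    rw [h₂, h, form_vec, form_vec] at e₂
    simp at e₁ e₂
    rw [h, e₁, e₂]
  have hlast (f) : a *ᵥ vec 0 0 0 0 f = vec 0 0 0 0 f := by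
    obtain ⟨y, z, h⟩ := ha.map_last f
    have e₁ := ha.isIsometry.form_mulVec (vec 0 0 0 0 f) (vec 1 0 0 0 0)
    have e₂ := ha.isIsometry.form_mulVec (vec 0 0 0 0 f) (vec 0 1 0 0 0)
    rw [h₁, h, form_vec, form_vec] at e₁
    rw [h₂, h, form_vec, form_vec] at e₂
    simp at e₁ e₂
    rw [h, e₁, e₂]
  refine mat_ext_mulVec fun x y z w f => ?_
  have hd : (vec x y z w f : Idx n → ℝ) = (x - z) • vec 1 0 0 0 0 + z • vec 1 0 1 0 0 +
      (y - w) • vec 0 1 0 0 0 + w • vec 0 1 0 1 0 + vec 0 0 0 0 f := by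
    simp [smul_vec, vec_add]
  rw [one_mulVec, hd]
  simp only [mulVec_add, mulVec_smul, h₁, h₂, hscaled, hlast, ha.map_null]

theorem eq_of_mem_SN {a b : GL (Idx n) ℝ} (ha : a ∈ SN n) (hb : b ∈ SN n)
    (h₁ : (a : Mat n) *ᵥ vec 1 0 0 0 0 = (b : Mat n) *ᵥ vec 1 0 0 0 0)
    (h₂ : (a : Mat n) *ᵥ vec 0 1 0 0 0 = (b : Mat n) *ᵥ vec 0 1 0 0 0) : a = b := by
  have h := preservesFlag_of_mem_SN (mul_mem (inv_mem hb) ha)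
  have h' : ((b⁻¹ * a : GL (Idx n) ℝ) : Mat n) = 1 := by
    refine h.eq_one ?_ ?_
    · rw [Units.val_mul, ← mulVec_mulVec, h₁, mulVec_mulVec, Units.inv_mul, one_mulVec]
    · rw [Units.val_mul, ← mulVec_mulVec, h₂, mulVec_mulVec, Units.inv_mul, one_mulVec]
  exact (inv_mul_eq_one.1 (Units.ext h')).symm

/-! ### The frame of a point of the orbit -/

/-- The coordinate of the hyperboloid that is determined by the others. -/
def hyp (t : Param n) : ℝ := √(1 + t.1 ^ 2 + t.2.1 ⬝ᵥ t.2.1)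

/-- The image of `e₁` under the element of `S_N` with coordinates `t`. -/
def frame₁ (t : Param n) : Idx n → ℝ :=
  vec (1 - (t.2.2.1 ^ 2 - t.2.2.2.1 ^ 2 - t.2.2.2.2 ⬝ᵥ t.2.2.2.2) / 2) t.2.2.1
    (-(t.2.2.1 ^ 2 - t.2.2.2.1 ^ 2 - t.2.2.2.2 ⬝ᵥ t.2.2.2.2) / 2) t.2.2.2.1 t.2.2.2.2

/-- The image of `e₂` under the element of `S_N` with coordinates `t`. -/
def frame₂ (t : Param n) : Idx n → ℝ :=
  vec (-(t.2.2.1 * hyp t - t.2.2.2.1 * t.1 - t.2.2.2.2 ⬝ᵥ t.2.1)) (hyp t)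
    (-(t.2.2.1 * hyp t - t.2.2.2.1 * t.1 - t.2.2.2.2 ⬝ᵥ t.2.1)) t.1 t.2.1

theorem dotProduct_self_nonneg_real (f : Fin (n - 1) → ℝ) : 0 ≤ f ⬝ᵥ f :=
  Finset.sum_nonneg fun i _ => mul_self_nonneg (f i)

theorem hyp_sq (t : Param n) : hyp t ^ 2 = 1 + t.1 ^ 2 + t.2.1 ⬝ᵥ t.2.1 :=
  Real.sq_sqrt (by have := dotProduct_self_nonneg_real t.2.1; positivity)

theorem hyp_sub_pos (t : Param n) : 0 < hyp t - t.1 := by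
  have h : t.1 < hyp t := Real.lt_sqrt_of_sq_lt (by
    have := dotProduct_self_nonneg_real t.2.1
    linarith)
  linarith

/-- The products among a e₁, a e₂ and the fixed vector e₁ + e₃ determine the first and third entries
of both frame vectors, and the square of the second entry of a e₂. Its sign follows from the
positivity of the scalar `l`. -/
theorem exists_frame_eq {a : GL (Idx n) ℝ} (ha : a ∈ SN n) :
    ∃ t : Param n, (a : Mat n) *ᵥ vec 1 0 0 0 0 = frame₁ t ∧
      (a : Mat n) *ᵥ vec 0 1 0 0 0 = frame₂ t := by
  have hf := preservesFlag_of_mem_SN ha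
  obtain ⟨l, hl, x, h⟩ := hf.map_scaled
  obtain ⟨x₁, k₂, x₃, k₄, k, h₁⟩ := exists_eq_vec ((a : Mat n) *ᵥ vec 1 0 0 0 0)
  obtain ⟨z₁, h₂, z₃, h₄, f, h₂'⟩ := exists_eq_vec ((a : Mat n) *ᵥ vec 0 1 0 0 0)
  have e11 := hf.isIsometry.form_mulVec (vec 1 0 0 0 0) (vec 1 0 0 0 0)
  have e22 := hf.isIsometry.form_mulVec (vec 0 1 0 0 0) (vec 0 1 0 0 0)
  have e12 := hf.isIsometry.form_mulVec (vec 1 0 0 0 0) (vec 0 1 0 0 0)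
  have e1l := hf.isIsometry.form_mulVec (vec 1 0 0 0 0) (vec 1 0 1 0 0)
  have e2l := hf.isIsometry.form_mulVec (vec 0 1 0 0 0) (vec 1 0 1 0 0)
  have e2m := hf.isIsometry.form_mulVec (vec 0 1 0 0 0) (vec 0 1 0 1 0)
  rw [h₁, form_vec, form_vec] at e11
  rw [h₂', form_vec, form_vec] at e22
  rw [h₁, h₂', form_vec, form_vec] at e12
  rw [h₁, hf.map_null, form_vec, form_vec] at e1l
  rw [h₂', hf.map_null, form_vec, form_vec] at e2l
  rw [h₂', h, form_vec, form_vec] at e2m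
  simp at e11 e22 e12 e1l e2l e2m
  have hz : z₁ = z₃ := by linarith
  subst hz
  -- Invariance of the product of e₂ with e₂ + e₄ gives l (h₂ - h₄) = 1. Since h₂² - h₄² = 1 + |f|²
  -- is positive, h₂ + h₄ is positive too, so h₂ is the positive root.
  have hpos : 0 < h₂ - h₄ := by
    have : l * (h₂ - h₄) = 1 := by linarith
    by_contra hneg
    nlinarith
  have hff := dotProduct_self_nonneg_real f
  have hsum : 0 < h₂ + h₄ := by
    by_contra hneg
    nlinarith
  have hhyp : hyp ((h₄, f, k₂, k₄, k) : Param n) = h₂ := by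
    rw [hyp, Real.sqrt_eq_iff_mul_self_eq_of_pos (by linarith)]
    simp only
    linarith
  have hx : x₁ = 1 + x₃ := by linarith
  subst hx
  refine ⟨(h₄, f, k₂, k₄, k), ?_, ?_⟩
  · rw [h₁, frame₁, vec_eq_vec_iff]
    refine ⟨?_, rfl, ?_, rfl, rfl⟩ <;> simp only <;> linarith
  · rw [h₂', frame₂, hhyp, vec_eq_vec_iff]
    refine ⟨?_, rfl, ?_, rfl, rfl⟩ <;> simp only <;> linarith

/-- The exponential as an invertible matrix. -/
def expGL (X : Mat n) : GL (Idx n) ℝ where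
  val := NormedSpace.exp X
  inv := NormedSpace.exp (-X)
  val_inv := by
    rw [← exp_add_of_commute _ _ (Commute.neg_right (Commute.refl X)), add_neg_cancel,
      NormedSpace.exp_zero]
  inv_val := by
    rw [← exp_add_of_commute _ _ (Commute.neg_left (Commute.refl X)), neg_add_cancel,
      NormedSpace.exp_zero]

theorem coe_expGL (X : Mat n) : (expGL X : Mat n) = NormedSpace.exp X := rfl

theorem continuous_expGL : Continuous (expGL : Mat n → GL (Idx n) ℝ) := by
  let _ : NormedAlgebra ℚ (Mat n) := NormedAlgebra.restrictScalars ℚ ℝ (Mat n)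
  have h : Continuous (NormedSpace.exp : Mat n → Mat n) := NormedSpace.exp_continuous
  exact Units.continuous_iff.2 ⟨h, h.comp continuous_neg⟩

/-- The element of `S_N` with coordinates `t`. -/
def groupElement (t : Param n) : GL (Idx n) ℝ :=
  -- From right to left: a boost of the (e₂, e₄)-plane gives e₂ an image whose second and fourth
  -- entries differ by hyp t - h₄, where h₄ = t.1. The next factor preserves this difference and
  -- adds its product with y to the last block, which explains the choice of y. Both factors fix e₁,
  -- and the leftmost one carries e₁ to `frame₁ t`.
  expGL (sNMat n (0, 0, t.2.2)) * expGL (sNMat n (0, (hyp t - t.1)⁻¹ • t.2.1, 0)) *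
    expGL (sNMat n (-Real.log (hyp t - t.1), 0))

theorem groupElement_mem (t : Param n) : groupElement t ∈ SN n := by
  have h (s : Param n) : expGL (sNMat n s) ∈ SN n :=
    Subgroup.subset_closure ⟨sNMat n s, mem_sN_iff.2 ⟨s, rfl⟩, rfl⟩
  exact mul_mem (mul_mem (h _) (h _)) (h _)

theorem groupElement_mulVec_e₁ (t : Param n) :
    (groupElement t : Mat n) *ᵥ vec 1 0 0 0 0 = frame₁ t := by
  obtain ⟨h₄, f, k₂, k₄, k⟩ := t
  have hfix (s : Param n) (hs : s.2.2 = 0) :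
      NormedSpace.exp (sNMat n s) *ᵥ vec 1 0 0 0 0 = vec 1 0 0 0 0 := by
    obtain ⟨r, y, l₂, l₄, l⟩ := s
    obtain ⟨rfl, rfl, rfl⟩ : l₂ = 0 ∧ l₄ = 0 ∧ l = 0 := by simpa using hs
    have h := exp_mulVec_of_eigenvector (X := sNMat n (r, y, 0, 0, 0)) (v := vec 1 0 0 0 0) (ρ := 0)
      (by rw [sNMat_mulVec]; simp [vec_zero])
    rwa [Real.exp_zero, one_smul] at h
  rw [groupElement, Units.val_mul, Units.val_mul, coe_expGL, coe_expGL, coe_expGL,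
    ← mulVec_mulVec, ← mulVec_mulVec, hfix _ rfl, hfix _ rfl, exp_mulVec_of_cube]
  · simp only [sNMat_mulVec, smul_vec, vec_add, frame₁, vec_eq_vec_iff]
    refine ⟨?_, ?_, ?_, ?_, ?_⟩ <;> simp <;> ring
  · simp only [sNMat_mulVec]
    simp [vec_zero]

theorem groupElement_mulVec_e₂ (t : Param n) :
    (groupElement t : Mat n) *ᵥ vec 0 1 0 0 0 = frame₂ t := by
  have hpos := hyp_sub_pos t
  have hne := hpos.ne'
  have hsq := hyp_sq t
  obtain ⟨h₄, f, k₂, k₄, k⟩ := t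
  set h := hyp ((h₄, f, k₂, k₄, k) : Param n) with hh
  simp only at hpos hsq hne
  have step₁ : NormedSpace.exp (sNMat n (-Real.log (h - h₄), 0)) *ᵥ vec 0 1 0 0 0 =
      vec 0 (((h - h₄) + (h - h₄)⁻¹) / 2) 0 (((h - h₄)⁻¹ - (h - h₄)) / 2) 0 := by
    have hd : (vec 0 1 0 0 0 : Idx n → ℝ) =
        (1 / 2 : ℝ) • vec 0 1 0 1 0 + (1 / 2 : ℝ) • vec 0 1 0 (-1) 0 := by
      simp [smul_vec, vec_add]; norm_num
    have e₁ := exp_mulVec_of_eigenvector (X := sNMat n (-Real.log (h - h₄), 0, 0, 0, 0))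
      (v := vec 0 1 0 1 0) (ρ := -Real.log (h - h₄)) (by rw [sNMat_mulVec, smul_vec]; simp)
    have e₂ := exp_mulVec_of_eigenvector (X := sNMat n (-Real.log (h - h₄), 0, 0, 0, 0))
      (v := vec 0 1 0 (-1) 0) (ρ := Real.log (h - h₄)) (by rw [sNMat_mulVec, smul_vec]; simp)
    rw [Real.exp_neg, Real.exp_log hpos] at e₁
    rw [Real.exp_log hpos] at e₂
    conv_lhs => rw [hd, mulVec_add, mulVec_smul, mulVec_smul]
    change (1 / 2 : ℝ) • NormedSpace.exp (sNMat n (-Real.log (h - h₄), 0, 0, 0, 0)) *ᵥ _ +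
      (1 / 2 : ℝ) • NormedSpace.exp (sNMat n (-Real.log (h - h₄), 0, 0, 0, 0)) *ᵥ _ = _
    rw [e₁, e₂]
    simp only [smul_vec, vec_add, vec_eq_vec_iff]
    refine ⟨?_, ?_, ?_, ?_, ?_⟩ <;> simp <;> ring
  have step₂ : NormedSpace.exp (sNMat n (0, (h - h₄)⁻¹ • f, 0)) *ᵥ
      vec 0 (((h - h₄) + (h - h₄)⁻¹) / 2) 0 (((h - h₄)⁻¹ - (h - h₄)) / 2) 0 =
      vec 0 h 0 h₄ f := by
    change NormedSpace.exp (sNMat n (0, (h - h₄)⁻¹ • f, 0, 0, 0)) *ᵥ _ = _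
    have hf : f ⬝ᵥ f = (h - h₄) * (h + h₄) - 1 := by linarith
    rw [exp_mulVec_of_cube]
    · simp only [sNMat_mulVec, smul_vec, vec_add, vec_eq_vec_iff]
      refine ⟨?_, ?_, ?_, ?_, ?_⟩
      · simp
      · simp [hf]; field_simp; ring
      · simp
      · simp [hf]; field_simp; ring
      · ext i; simp; field_simp; ring
    · simp only [sNMat_mulVec]
      simp [vec_zero]
  rw [groupElement, Units.val_mul, Units.val_mul, coe_expGL, coe_expGL, coe_expGL,
    ← mulVec_mulVec, ← mulVec_mulVec]
  simp only [← hh]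
  rw [step₁, step₂, exp_mulVec_of_cube]
  · simp only [sNMat_mulVec, smul_vec, vec_add, frame₂, vec_eq_vec_iff]
    refine ⟨?_, ?_, ?_, ?_, ?_⟩ <;> simp [← hh] <;> ring
  · simp only [sNMat_mulVec]
    simp [vec_zero]

end Group

/-! ### The orbit -/

section Orbit

variable {n : ℕ}

/-- The skew-adjoint endomorphism `v ↦ ⟨y, v⟩ x - ⟨x, v⟩ y`. -/
def wedge (x y : Idx n → ℝ) : Mat n :=
  vecMulVec x (formMat n *ᵥ y) - vecMulVec y (formMat n *ᵥ x)

theorem wedge_mulVec (x y v : Idx n → ℝ) : wedge x y *ᵥ v = form y v • x - form x v • y := by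
  rw [wedge, sub_mulVec, vecMulVec_mulVec, vecMulVec_mulVec, dotProduct_comm _ v,
    dotProduct_comm _ v, form_comm y, form_comm x, form, form]
  simp

theorem Ad_sub (a : GL (Idx n) ℝ) (X Y : Mat n) : Ad a (X - Y) = Ad a X - Ad a Y := by
  simp only [Ad, mul_sub, sub_mul]

theorem Ad_smul (a : GL (Idx n) ℝ) (r : ℝ) (X : Mat n) : Ad a (r • X) = r • Ad a X := by
  simp only [Ad, mul_smul_comm, smul_mul_assoc]

/-- For an isometry, the covector ⟨y, ·⟩ composed with a⁻¹ is ⟨a y, ·⟩. -/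
theorem IsIsometry.Ad_wedge {a : GL (Idx n) ℝ} (ha : IsIsometry (a : Mat n)) (x y : Idx n → ℝ) :
    Ad a (wedge x y) = wedge ((a : Mat n) *ᵥ x) ((a : Mat n) *ᵥ y) := by
  have h (v : Idx n → ℝ) : (formMat n *ᵥ v) ᵥ* ((a⁻¹ : GL (Idx n) ℝ) : Mat n) =
      formMat n *ᵥ ((a : Mat n) *ᵥ v) := by
    have h1 := congrArg transpose ha.formMat_mul_inv
    rw [transpose_mul, transpose_mul, transpose_transpose, formMat_transpose] at h1
    rw [← mulVec_transpose, mulVec_mulVec, h1, mulVec_mulVec]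
  rw [wedge, Ad_sub, Ad, Ad, mul_vecMulVec, mul_vecMulVec, vecMulVec_mul, vecMulVec_mul, h, h,
    wedge]

theorem Z_eq_wedge : Z n = wedge (vec 1 0 0 0 0) (vec 0 1 0 0 0) := by
  refine mat_ext_mulVec fun a b c d f => ?_
  rw [Z, block_mulVec, wedge_mulVec, form_vec, form_vec, sub_eq_add_neg, ← neg_smul, smul_vec,
    smul_vec, vec_add]
  simp [U]

theorem velocity_N_eq_wedge :
    velocity (N n) (Z n) = (2 : ℝ) • wedge (vec 0 1 0 0 0) (vec 0 0 1 0 0) := by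
  refine mat_ext_mulVec fun a b c d f => ?_
  rw [velocity_N, block_mulVec, smul_mulVec, wedge_mulVec, form_vec, form_vec, sub_eq_add_neg,
    ← neg_smul, smul_vec, smul_vec, vec_add, smul_vec]
  simp

/-- The point of the orbit with coordinates `t`. -/
def point (t : Param n) : Mat n := wedge (frame₁ t) (frame₂ t)

/-- The unit normal vector of the orbit at the point with coordinates `t`. -/
def normalAt (t : Param n) : Mat n := (2 : ℝ) • wedge (frame₂ t) (vec 1 0 1 0 0 - frame₁ t)

/-- The coordinates of a point of the orbit. -/
def coords (p : Mat n) : Param n :=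
  (-(p *ᵥ vec 1 0 1 0 0) (.inr (.inl 1)), fun i => -(p *ᵥ vec 1 0 1 0 0) (.inr (.inr i)),
    -((p * p) *ᵥ vec 1 0 1 0 0) (.inl 1), -((p * p) *ᵥ vec 1 0 1 0 0) (.inr (.inl 1)),
    fun i => -((p * p) *ᵥ vec 1 0 1 0 0) (.inr (.inr i)))

theorem Ad_Z_eq_point {a : GL (Idx n) ℝ} (ha : a ∈ SN n) {t : Param n}
    (h₁ : (a : Mat n) *ᵥ vec 1 0 0 0 0 = frame₁ t)
    (h₂ : (a : Mat n) *ᵥ vec 0 1 0 0 0 = frame₂ t) : Ad a (Z n) = point t := by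
  rw [Z_eq_wedge, (preservesFlag_of_mem_SN ha).isIsometry.Ad_wedge, h₁, h₂, point]

theorem Ad_velocity_N_eq_normalAt {a : GL (Idx n) ℝ} (ha : a ∈ SN n) {t : Param n}
    (h₁ : (a : Mat n) *ᵥ vec 1 0 0 0 0 = frame₁ t)
    (h₂ : (a : Mat n) *ᵥ vec 0 1 0 0 0 = frame₂ t) :
    Ad a (velocity (N n) (Z n)) = normalAt t := by
  have hf := preservesFlag_of_mem_SN ha
  -- e₃ is the fixed vector e₁ + e₃ minus e₁, so a e₃ is a function of a e₁. Hence the normal vector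
  -- depends on the frame alone.
  have h3 : (vec 0 0 1 0 0 : Idx n → ℝ) = vec 1 0 1 0 0 - vec 1 0 0 0 0 := by
    rw [eq_sub_iff_add_eq, vec_add]; simp
  rw [velocity_N_eq_wedge, Ad_smul, hf.isIsometry.Ad_wedge, h3, mulVec_sub, hf.map_null, h₁, h₂,
    normalAt]

theorem Ad_groupElement_Z (t : Param n) : Ad (groupElement t) (Z n) = point t :=
  Ad_Z_eq_point (groupElement_mem t) (groupElement_mulVec_e₁ t) (groupElement_mulVec_e₂ t)

theorem Ad_mul_inv_cancel (a : GL (Idx n) ℝ) (X : Mat n) (v : Idx n → ℝ) :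
    Ad a X *ᵥ ((a : Mat n) *ᵥ v) = (a : Mat n) *ᵥ (X *ᵥ v) := by
  rw [Ad, mulVec_mulVec, mul_assoc, Units.inv_mul, mul_one, mulVec_mulVec]

/-- Z maps e₁ + e₃ to -e₂ and the group fixes e₁ + e₃. With the next lemma, this recovers the frame
from the point without reference to a group element, and makes `coords` a polynomial left inverse of
`point`. -/
theorem point_mulVec_null (t : Param n) : point t *ᵥ vec 1 0 1 0 0 = -frame₂ t := by
  have hf := preservesFlag_of_mem_SN (groupElement_mem t)
  rw [← Ad_groupElement_Z]
  conv_lhs => rw [← hf.map_null, Ad_mul_inv_cancel]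
  rw [← groupElement_mulVec_e₂, ← mulVec_neg, Z, block_mulVec]
  congr 1
  rw [← neg_one_smul ℝ, smul_vec]
  simp [U]

theorem point_mul_point_mulVec_null (t : Param n) :
    (point t * point t) *ᵥ vec 1 0 1 0 0 = -frame₁ t := by
  rw [← mulVec_mulVec, point_mulVec_null, ← groupElement_mulVec_e₂, ← groupElement_mulVec_e₁,
    mulVec_neg, ← Ad_groupElement_Z, Ad_mul_inv_cancel, Z, block_mulVec]
  simp [U]

theorem coords_point (t : Param n) : coords (point t) = t := by
  rw [coords, point_mulVec_null, point_mul_point_mulVec_null]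
  simp [frame₁, frame₂, vec]

theorem point_mem_orbitSN (t : Param n) : point t ∈ orbitSN n :=
  ⟨groupElement t, groupElement_mem t, (Ad_groupElement_Z t).symm⟩

theorem exists_point_eq {p : Mat n} (hp : p ∈ orbitSN n) : ∃ t, p = point t := by
  obtain ⟨a, ha, rfl⟩ := hp
  obtain ⟨t, h₁, h₂⟩ := exists_frame_eq ha
  exact ⟨t, Ad_Z_eq_point ha h₁ h₂⟩

theorem point_coords {p : Mat n} (hp : p ∈ orbitSN n) : point (coords p) = p := by
  obtain ⟨t, rfl⟩ := exists_point_eq hp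
  rw [coords_point]

theorem frame_eq_of_mem_SN {a : GL (Idx n) ℝ} (ha : a ∈ SN n) :
    (a : Mat n) *ᵥ vec 1 0 0 0 0 = frame₁ (coords (Ad a (Z n))) ∧
      (a : Mat n) *ᵥ vec 0 1 0 0 0 = frame₂ (coords (Ad a (Z n))) := by
  obtain ⟨t, h₁, h₂⟩ := exists_frame_eq ha
  rw [Ad_Z_eq_point ha h₁ h₂, coords_point]
  exact ⟨h₁, h₂⟩

/-- Both elements have the same frame, and the frame determines an element of S_N. This gives the
orbit map a continuous explicit inverse. -/
theorem groupElement_coords {a : GL (Idx n) ℝ} (ha : a ∈ SN n) :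
    groupElement (coords (Ad a (Z n))) = a := by
  obtain ⟨h₁, h₂⟩ := frame_eq_of_mem_SN ha
  exact eq_of_mem_SN (groupElement_mem _) ha ((groupElement_mulVec_e₁ _).trans h₁.symm)
    ((groupElement_mulVec_e₂ _).trans h₂.symm)

/-! ### Smoothness of the parametrization -/

theorem contDiff_matrix {F : Type*} [NormedAddCommGroup F] [NormedSpace ℝ F] {k : WithTop ℕ∞}
    {f : F → Mat n} (hf : ∀ i j, ContDiff ℝ k fun x => f x i j) : ContDiff ℝ k f := by
  have h : f = fun x => ∑ i, ∑ j, f x i j • (Matrix.single i j 1 : Mat n) := by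
    funext x
    conv_lhs => rw [matrix_eq_sum_single (f x)]
    simp [smul_single]
  rw [h]
  exact ContDiff.sum fun i _ => ContDiff.sum fun j _ => (hf i j).smul contDiff_const

theorem contDiff_entry (i j : Idx n) {k : WithTop ℕ∞} : ContDiff ℝ k fun p : Mat n => p i j :=
  (LinearMap.toContinuousLinearMap (Matrix.entryLinearMap ℝ ℝ i j : Mat n →ₗ[ℝ] ℝ)).contDiff

theorem contDiff_mulVec_const (v : Idx n → ℝ) (i : Idx n) {k : WithTop ℕ∞} :
    ContDiff ℝ k fun p : Mat n => (p *ᵥ v) i := by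
  simp only [mulVec, dotProduct]
  exact ContDiff.sum fun j _ => (contDiff_entry i j).mul contDiff_const

theorem contDiff_coords {k : WithTop ℕ∞} : ContDiff ℝ k (coords : Mat n → Param n) := by
  have h2 (i : Idx n) : ContDiff ℝ k fun p : Mat n => ((p * p) *ᵥ vec 1 0 1 0 0) i :=
    (contDiff_mulVec_const _ i).comp (contDiff_id.mul contDiff_id)
  exact (contDiff_mulVec_const _ _).neg.prodMk
    ((contDiff_pi.2 fun i => (contDiff_mulVec_const _ _).neg).prodMk
      ((h2 _).neg.prodMk ((h2 _).neg.prodMk (contDiff_pi.2 fun i => (h2 _).neg))))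

theorem contDiff_hyp {k : WithTop ℕ∞} : ContDiff ℝ k (hyp : Param n → ℝ) := by
  unfold hyp dotProduct
  refine ContDiff.sqrt (by fun_prop) fun t => ?_
  have := dotProduct_self_nonneg_real t.2.1
  unfold dotProduct at this
  positivity

theorem contDiff_vec {F : Type*} [NormedAddCommGroup F] [NormedSpace ℝ F] {k : WithTop ℕ∞}
    {a b c d : F → ℝ} {f : F → Fin (n - 1) → ℝ} (ha : ContDiff ℝ k a) (hb : ContDiff ℝ k b)
    (hc : ContDiff ℝ k c) (hd : ContDiff ℝ k d) (hf : ContDiff ℝ k f) :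
    ContDiff ℝ k fun x => (vec (a x) (b x) (c x) (d x) (f x) : Idx n → ℝ) := by
  refine contDiff_pi.2 ?_
  rintro (i | i | i)
  · fin_cases i
    exacts [ha, hb]
  · fin_cases i
    exacts [hc, hd]
  · exact contDiff_pi.1 hf i

theorem contDiff_frame₁ {k : WithTop ℕ∞} : ContDiff ℝ k (frame₁ : Param n → Idx n → ℝ) := by
  unfold frame₁ dotProduct
  apply contDiff_vec <;> fun_prop

theorem contDiff_frame₂ {k : WithTop ℕ∞} : ContDiff ℝ k (frame₂ : Param n → Idx n → ℝ) := by
  have h := contDiff_hyp (n := n) (k := k)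
  unfold frame₂ dotProduct
  apply contDiff_vec <;> fun_prop

theorem contDiff_wedge {F : Type*} [NormedAddCommGroup F] [NormedSpace ℝ F] {k : WithTop ℕ∞}
    {x y : F → Idx n → ℝ} (hx : ContDiff ℝ k x) (hy : ContDiff ℝ k y) :
    ContDiff ℝ k fun s => wedge (x s) (y s) := by
  refine contDiff_matrix fun i j => ?_
  simp only [wedge, Matrix.sub_apply, vecMulVec_apply, mulVec, dotProduct]
  rw [contDiff_pi] at hx hy
  fun_prop

theorem contDiff_point {k : WithTop ℕ∞} : ContDiff ℝ k (point : Param n → Mat n) :=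
  contDiff_wedge contDiff_frame₁ contDiff_frame₂

theorem contDiff_normalAt {k : WithTop ℕ∞} : ContDiff ℝ k (normalAt : Param n → Mat n) :=
  (contDiff_wedge contDiff_frame₂ (contDiff_const.sub contDiff_frame₁)).const_smul (2 : ℝ)

theorem continuous_groupElement : Continuous (groupElement : Param n → GL (Idx n) ℝ) := by
  have h : Continuous (hyp : Param n → ℝ) := (contDiff_hyp (k := 0)).continuous
  have hs : Continuous (sNMat n) := (sNMat n).continuous_of_finiteDimensional
  have hd : Continuous fun t : Param n => hyp t - t.1 := h.sub continuous_fst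
  have hne (t : Param n) : hyp t - t.1 ≠ 0 := (hyp_sub_pos t).ne'
  have hinv := hd.inv₀ hne
  have hlog := hd.log hne
  refine ((continuous_expGL.comp (hs.comp ?_)).mul (continuous_expGL.comp (hs.comp ?_))).mul
    (continuous_expGL.comp (hs.comp ?_)) <;> fun_prop

/-- The global chart of the orbit. -/
def orbitHomeomorph (n : ℕ) : orbitSN n ≃ₜ Param n where
  toFun p := coords p.1
  invFun t := ⟨point t, point_mem_orbitSN t⟩
  left_inv p := Subtype.ext (point_coords p.2)
  right_inv t := coords_point t
  continuous_toFun := (contDiff_coords (k := 0)).continuous.comp continuous_subtype_val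
  continuous_invFun := (contDiff_point (k := 0)).continuous.subtype_mk _

/-- The orbit map as a homeomorphism. -/
def orbitMapHomeomorph (n : ℕ) : SN n ≃ₜ orbitSN n where
  toFun a := ⟨Ad a.1 (Z n), a.1, a.2, rfl⟩
  invFun p := ⟨groupElement (coords p.1), groupElement_mem _⟩
  left_inv a := Subtype.ext (groupElement_coords a.2)
  right_inv p := Subtype.ext ((Ad_groupElement_Z _).trans (point_coords p.2))
  continuous_toFun := by
    refine Continuous.subtype_mk ?_ _
    have h1 : Continuous fun a : SN n => ((a.1 : GL (Idx n) ℝ) : Mat n) :=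
      Units.continuous_val.comp continuous_subtype_val
    have h2 : Continuous fun a : SN n => ((a.1⁻¹ : GL (Idx n) ℝ) : Mat n) :=
      Units.continuous_val.comp continuous_subtype_val.inv
    exact (h1.mul continuous_const).mul h2
  continuous_invFun := by
    refine Continuous.subtype_mk ?_ _
    exact continuous_groupElement.comp
      ((contDiff_coords (k := 0)).continuous.comp continuous_subtype_val)

theorem isEmbedding_orbitMap (n : ℕ) :
    Topology.IsEmbedding (fun a : SN n => Ad a.1 (Z n)) :=
  Topology.IsEmbedding.subtypeVal.comp (orbitMapHomeomorph n).isEmbedding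

end Orbit

/-! ### The tangent space at the origin -/

section Tangent

variable {n : ℕ}

theorem Z_mulVec (a b c d : ℝ) (f : Fin (n - 1) → ℝ) :
    Z n *ᵥ vec a b c d f = vec b (-a) 0 0 0 := by
  rw [Z, block_mulVec]
  simp [U]

theorem velocity_mulVec (X p : Mat n) (v : Idx n → ℝ) :
    velocity X p *ᵥ v = X *ᵥ (p *ᵥ v) - p *ᵥ (X *ᵥ v) := by
  rw [velocity, sub_mulVec, mulVec_mulVec, mulVec_mulVec]

theorem vec_inl_zero (a b c d : ℝ) (f : Fin (n - 1) → ℝ) :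
    (vec a b c d f : Idx n → ℝ) (.inl 0) = a := rfl

theorem vec_inl_one (a b c d : ℝ) (f : Fin (n - 1) → ℝ) :
    (vec a b c d f : Idx n → ℝ) (.inl 1) = b := rfl

theorem vec_sub (a b c d a' b' c' d' : ℝ) (f f' : Fin (n - 1) → ℝ) :
    (vec a b c d f : Idx n → ℝ) - vec a' b' c' d' f' =
      vec (a - a') (b - b') (c - c') (d - d') (f - f') := by
  rw [sub_eq_iff_eq_add, vec_add]
  simp

theorem velocity_sNMat_mulVec (r k₂ k₄ : ℝ) (y k : Fin (n - 1) → ℝ) (a b c d : ℝ)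
    (f : Fin (n - 1) → ℝ) :
    velocity (sNMat n (r, y, k₂, k₄, k)) (Z n) *ᵥ vec a b c d f =
      vec (-r * d + k₂ * c - y ⬝ᵥ f) (k₄ * d + k ⬝ᵥ f) (k₂ * a) (-r * a + k₄ * b)
        (b • k - a • y) := by
  rw [velocity_mulVec, Z_mulVec, sNMat_mulVec, sNMat_mulVec, Z_mulVec, vec_sub, vec_eq_vec_iff]
  refine ⟨?_, ?_, ?_, ?_, ?_⟩
  · simp; ring
  · simp; ring
  · simp
  · simp; ring
  · simp [sub_eq_add_neg]

theorem eq_zero_of_velocity_sNMat_eq_zero {t : Param n}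
    (h : velocity (sNMat n t) (Z n) = 0) : t = 0 := by
  obtain ⟨r, y, k₂, k₄, k⟩ := t
  have h₁ := congrArg (· *ᵥ vec 1 0 0 0 0) h
  have h₂ := congrArg (· *ᵥ vec 0 1 0 0 0) h
  simp only [velocity_sNMat_mulVec, zero_mulVec, ← vec_zero, vec_eq_vec_iff] at h₁ h₂
  simp at h₁ h₂
  obtain ⟨h₁, h₃, h₄⟩ := h₁
  obtain ⟨h₅, h₆⟩ := h₂
  simp [*]

theorem velocity_N_mulVec (a b c d : ℝ) (f : Fin (n - 1) → ℝ) :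
    velocity (N n) (Z n) *ᵥ vec a b c d f = vec 0 (-2 * c) (-2 * b) 0 0 := by
  rw [velocity_N, block_mulVec]
  simp

/-- The bracket with Z annihilates 𝔨 and lands in 𝔭, so the result is symmetric with only the
off-diagonal blocks, and is given by the images of e₁ and e₂. -/
theorem mulVec_eq_of_mem_so {Y : Mat n} (hY : Y ∈ so n) :
    ∃ p q p' q' g g', ∀ a b c d f, velocity Y (Z n) *ᵥ vec a b c d f =
      vec (c * p + d * q + f ⬝ᵥ g) (c * p' + d * q' + f ⬝ᵥ g') (a * p + b * p') (a * q + b * q')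
        (a • g + b • g') := by
  obtain ⟨a₁, b₁, p', q', g', h₁⟩ := exists_eq_vec (Y *ᵥ vec 1 0 0 0 0)
  obtain ⟨a₂, b₂, p, q, g, h₂⟩ := exists_eq_vec (Y *ᵥ vec 0 1 0 0 0)
  have e₁₁ := form_mulVec_of_mem_so hY (vec 1 0 0 0 0) (vec 1 0 0 0 0)
  have e₂₂ := form_mulVec_of_mem_so hY (vec 0 1 0 0 0) (vec 0 1 0 0 0)
  have e₁₂ := form_mulVec_of_mem_so hY (vec 1 0 0 0 0) (vec 0 1 0 0 0)
  rw [h₁, form_vec, form_vec] at e₁₁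
  rw [h₂, form_vec, form_vec] at e₂₂
  rw [h₁, h₂, form_vec, form_vec] at e₁₂
  simp at e₁₁ e₂₂ e₁₂
  obtain rfl : a₁ = 0 := by linarith
  obtain rfl : b₂ = 0 := by linarith
  -- Z maps e₁ to -e₂ and e₂ to e₁, so the image of e₁ under the bracket comes from minus `Y` e₂,
  -- and that of e₂ from `Y` e₁.
  refine ⟨-p, -q, p', q', -g, g', fun a b c d f => ?_⟩
  obtain ⟨x, z, x', z', l, h₃⟩ := exists_eq_vec (Y *ᵥ vec 0 0 c d f)
  have e₁₃ := form_mulVec_of_mem_so hY (vec 1 0 0 0 0) (vec 0 0 c d f)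
  have e₂₃ := form_mulVec_of_mem_so hY (vec 0 1 0 0 0) (vec 0 0 c d f)
  rw [h₁, h₃, form_vec, form_vec] at e₁₃
  rw [h₂, h₃, form_vec, form_vec] at e₂₃
  simp at e₁₃ e₂₃
  have hd (a b c d : ℝ) (f : Fin (n - 1) → ℝ) : (vec a b c d f : Idx n → ℝ) =
      a • vec 1 0 0 0 0 + b • vec 0 1 0 0 0 + vec 0 0 c d f := by
    simp [smul_vec, vec_add]
  have hY' (a b : ℝ) : Y *ᵥ vec a b 0 0 0 = vec (b * a₂) (a * b₁) (a * p' + b * p)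
      (a * q' + b * q) (a • g' + b • g) := by
    rw [hd, vec_zero, add_zero, mulVec_add, mulVec_smul, mulVec_smul, h₁, h₂, smul_vec, smul_vec,
      vec_add]
    simp
  have hY'' : Y *ᵥ vec a b c d f = vec (b * a₂ + x) (a * b₁ + z) (a * p' + b * p + x')
      (a * q' + b * q + z') (a • g' + b • g + l) := by
    have : (vec a b c d f : Idx n → ℝ) = vec a b 0 0 0 + vec 0 0 c d f := by simp [vec_add]
    rw [this, mulVec_add, hY', h₃, vec_add]
  rw [velocity_mulVec, Z_mulVec, hY', hY'', Z_mulVec, vec_sub, vec_eq_vec_iff, dotProduct_neg,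
    dotProduct_comm f, dotProduct_comm f]
  subst e₁₂
  refine ⟨?_, ?_, ?_, ?_, ?_⟩
  · linarith
  · linarith
  · ring
  · ring
  · ext i; simp; ring

/-- Among the entries of a tangent vector at o, 𝔰_N reaches all but the e₃-component p' of the image
of e₂. The direction of `N` consists of exactly this entry, with value -2. -/
theorem exists_velocity_eq {Y : Mat n} (hY : Y ∈ so n) : ∃ (t : Param n) (r : ℝ),
    velocity Y (Z n) = velocity (sNMat n t) (Z n) + r • velocity (N n) (Z n) := by
  obtain ⟨p, q, p', q', g, g', h⟩ := mulVec_eq_of_mem_so hY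
  refine ⟨(-q, -g, p, q', g'), -p' / 2, mat_ext_mulVec fun a b c d f => ?_⟩
  rw [h, add_mulVec, smul_mulVec, velocity_sNMat_mulVec, velocity_N_mulVec, smul_vec, vec_add,
    vec_eq_vec_iff, dotProduct_comm f, dotProduct_comm f]
  refine ⟨?_, ?_, ?_, ?_, ?_⟩
  · simp; ring
  · ring
  · ring
  · ring
  · simp [add_comm]

theorem J_J_velocity {Y : Mat n} (hY : Y ∈ so n) :
    J (Z n) (J (Z n) (velocity Y (Z n))) = -velocity Y (Z n) := by
  obtain ⟨p, q, p', q', g, g', h⟩ := mulVec_eq_of_mem_so hY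
  refine mat_ext_mulVec fun a b c d f => ?_
  have hJ (w : Mat n) (v : Idx n → ℝ) : J (Z n) w *ᵥ v = Z n *ᵥ (w *ᵥ v) - w *ᵥ (Z n *ᵥ v) := by
    rw [J, sub_mulVec, mulVec_mulVec, mulVec_mulVec]
  simp only [hJ, h, Z_mulVec, vec_sub]
  rw [neg_mulVec, h, ← neg_one_smul ℝ (vec _ _ _ _ _), smul_vec, vec_eq_vec_iff]
  refine ⟨?_, ?_, ?_, ?_, ?_⟩
  · simp
  · simp
  · ring
  · ring
  · ext i; simp; ring

/-- The velocity is a symmetric matrix, so the trace of its square is the sum of the squares of its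
entries. -/
theorem trace_velocity_mul_self_pos {t : Param n} (ht : t ≠ 0) :
    0 < trace (velocity (sNMat n t) (Z n) * velocity (sNMat n t) (Z n)) := by
  have hne : velocity (sNMat n t) (Z n) ≠ 0 := fun h => ht (eq_zero_of_velocity_sNMat_eq_zero h)
  have hsymm : (velocity (sNMat n t) (Z n))ᵀ = velocity (sNMat n t) (Z n) := by
    obtain ⟨r, y, k₂, k₄, k⟩ := t
    refine ext_of_mulVec_single fun j => dotProduct_eq _ _ fun x => ?_
    obtain ⟨a, b, c, d, f, rfl⟩ := exists_eq_vec x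
    obtain ⟨a', b', c', d', f', hv⟩ := exists_eq_vec (Pi.single j 1 : Idx n → ℝ)
    rw [hv, mulVec_transpose, ← dotProduct_mulVec, velocity_sNMat_mulVec, velocity_sNMat_mulVec,
      vec_dotProduct_vec, vec_dotProduct_vec]
    simp only [sub_dotProduct, smul_dotProduct, smul_eq_mul, dotProduct_comm f']
    ring
  have hpos : 0 ≤ trace ((velocity (sNMat n t) (Z n))ᵀ * velocity (sNMat n t) (Z n)) :=
    Finset.sum_nonneg fun i _ => by
      rw [diag_apply, mul_apply]
      exact Finset.sum_nonneg fun j _ => mul_self_nonneg _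
  have hne' : trace ((velocity (sNMat n t) (Z n))ᵀ * velocity (sNMat n t) (Z n)) ≠ 0 := by
    intro h
    exact hne (trace_conjTranspose_mul_self_eq_zero_iff.1 (by simpa using h))
  rw [hsymm] at hpos hne'
  exact lt_of_le_of_ne hpos hne'.symm

theorem trace_Z_mul (M : Mat n) : trace (Z n * M) =
    (M *ᵥ vec 1 0 0 0 0) (.inl 1) - (M *ᵥ vec 0 1 0 0 0) (.inl 0) := by
  simp [Z, trace, mul_apply, block, Fintype.sum_sum_type, Fin.sum_univ_two, mulVec, dotProduct,
    vec, U]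
  ring

/-- The trace of w J w' equals that of Z [w', w], which needs only two entries of a commutator. The
parameters k₂ and k₂' disappear because they measure the component along ξ, which Φ annihilates. -/
theorem metric_J_velocity (r k₂ k₄ r' k₂' k₄' : ℝ) (y k y' k' : Fin (n - 1) → ℝ) :
    metric (velocity (sNMat n (r, y, k₂, k₄, k)) (Z n))
      (J (Z n) (velocity (sNMat n (r', y', k₂', k₄', k')) (Z n))) =
      -(1 / 4) * (-(r' * k₄) - y' ⬝ᵥ k + r * k₄' + y ⬝ᵥ k') := by
  have h (w w' : Mat n) : trace (w * J (Z n) w') = trace (Z n * (w' * w - w * w')) := by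
    rw [J, mul_sub, mul_sub, trace_sub, trace_sub, ← mul_assoc w, trace_mul_comm (w * Z n) w',
      ← mul_assoc w', trace_mul_comm (w' * w) (Z n), ← mul_assoc w, trace_mul_comm (w * w') (Z n)]
  rw [metric, h, trace_Z_mul, sub_mulVec, sub_mulVec]
  simp only [← mulVec_mulVec, velocity_sNMat_mulVec, vec_sub]
  rw [c₀_sq, vec_inl_one, vec_inl_zero]
  simp only [zero_smul, one_smul, dotProduct_comm k, dotProduct_comm k' y, sub_zero, zero_sub,
    dotProduct_neg, neg_dotProduct]
  ring

/-! ### Invariance under the group -/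

theorem Ad_mul (a : GL (Idx n) ℝ) (X Y : Mat n) : Ad a (X * Y) = Ad a X * Ad a Y := by
  simp only [Ad, mul_assoc]
  rw [← mul_assoc ((a⁻¹ : GL (Idx n) ℝ) : Mat n) (a : Mat n), Units.inv_mul, one_mul]

theorem Ad_add (a : GL (Idx n) ℝ) (X Y : Mat n) : Ad a (X + Y) = Ad a X + Ad a Y := by
  simp only [Ad, mul_add, add_mul]

theorem Ad_neg (a : GL (Idx n) ℝ) (X : Mat n) : Ad a (-X) = -Ad a X := by
  simp only [Ad, mul_neg, neg_mul]

theorem Ad_velocity (a : GL (Idx n) ℝ) (X p : Mat n) :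
    Ad a (velocity X p) = velocity (Ad a X) (Ad a p) := by
  rw [velocity, velocity, Ad_sub, Ad_mul, Ad_mul]

theorem Ad_J (a : GL (Idx n) ℝ) (p X : Mat n) : Ad a (J p X) = J (Ad a p) (Ad a X) := by
  rw [J, J, Ad_sub, Ad_mul, Ad_mul]

theorem metric_Ad (a : GL (Idx n) ℝ) (X Y : Mat n) : metric (Ad a X) (Ad a Y) = metric X Y := by
  rw [metric, metric, ← Ad_mul, Ad, trace_mul_comm, ← mul_assoc, Units.inv_mul, one_mul]

theorem Ad_inv_Ad (a : GL (Idx n) ℝ) (X : Mat n) : Ad a (Ad a⁻¹ X) = X := by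
  simp only [Ad, inv_inv, mul_assoc]
  rw [← mul_assoc, Units.mul_inv, one_mul, mul_one]

theorem Ad_eq_zero {a : GL (Idx n) ℝ} {X : Mat n} (h : Ad a X = 0) : X = 0 := by
  have h1 := Ad_inv_Ad a⁻¹ X
  rw [inv_inv, h] at h1
  rw [← h1]
  simp [Ad]

theorem Ad_mem_so {a : GL (Idx n) ℝ} (ha : IsIsometry (a : Mat n)) {X : Mat n} (hX : X ∈ so n) :
    Ad a X ∈ so n := by
  refine mem_so_of_form fun x y => ?_
  have hinv (v : Idx n → ℝ) : v = (a : Mat n) *ᵥ (((a⁻¹ : GL (Idx n) ℝ) : Mat n) *ᵥ v) := by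
    rw [mulVec_mulVec, Units.mul_inv, one_mulVec]
  rw [hinv x, hinv y, Ad_mul_inv_cancel, Ad_mul_inv_cancel, ha.form_mulVec, ha.form_mulVec,
    form_mulVec_of_mem_so hX]

theorem metric_comm (u v : Mat n) : metric u v = metric v u := by
  rw [metric, metric, trace_mul_comm]

theorem metric_J_left (p u v : Mat n) : metric (J p u) v = -metric u (J p v) := by
  rw [metric, metric, ← mul_neg]
  congr 1
  rw [J, J, sub_mul, mul_sub, trace_sub, trace_sub, mul_assoc p, trace_mul_comm p, mul_assoc u p,
    mul_assoc u v]
  ring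

theorem N_mem_so : N n ∈ so n := by
  refine mem_so_of_form fun v w => ?_
  obtain ⟨a, b, c, d, f, rfl⟩ := exists_eq_vec v
  obtain ⟨a', b', c', d', f', rfl⟩ := exists_eq_vec w
  rw [N_eq, block_mulVec, block_mulVec, form_vec, form_vec]
  simp
  ring

theorem Z_mem_so : Z n ∈ so n := by
  refine mem_so_of_form fun v w => ?_
  obtain ⟨a, b, c, d, f, rfl⟩ := exists_eq_vec v
  obtain ⟨a', b', c', d', f', rfl⟩ := exists_eq_vec w
  rw [Z_mulVec, Z_mulVec, form_vec, form_vec]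
  simp

theorem velocity_mem_so {X Y : Mat n} (hX : X ∈ so n) (hY : Y ∈ so n) : velocity X Y ∈ so n := by
  rw [mem_so_iff] at *
  have h (A C : Mat n) (hA : Aᵀ * formMat n = -(formMat n * A))
      (hC : Cᵀ * formMat n = -(formMat n * C)) :
      (A * C)ᵀ * formMat n = formMat n * (C * A) := by
    rw [transpose_mul, mul_assoc, hA, mul_neg, ← mul_assoc, hC, neg_mul, neg_neg, mul_assoc]
  rw [velocity, transpose_sub, sub_mul, h X Y hX hY, h Y X hY hX, mul_sub, neg_sub]

theorem isTangent_iff {t : Param n} {w : Mat n} : IsTangent (point t) w ↔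
    ∃ (s : Param n) (r : ℝ), w =
      Ad (groupElement t) (velocity (sNMat n s) (Z n)) + r • normalAt t := by
  have ha := (preservesFlag_of_mem_SN (groupElement_mem t)).isIsometry
  have hν := Ad_velocity_N_eq_normalAt (groupElement_mem t) (groupElement_mulVec_e₁ t)
    (groupElement_mulVec_e₂ t)
  rw [← Ad_groupElement_Z, ← hν]
  constructor
  · rintro ⟨X, hX, rfl⟩
    obtain ⟨s, r, h⟩ := exists_velocity_eq (Ad_mem_so ha.inv hX)
    refine ⟨s, r, ?_⟩
    rw [← Ad_smul, ← Ad_add, ← h, Ad_velocity, Ad_inv_Ad]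
  · rintro ⟨s, r, rfl⟩
    refine ⟨Ad (groupElement t) (sNMat n s + r • N n),
      Ad_mem_so ha (add_mem (sNMat_mem_so s) (Submodule.smul_mem _ r N_mem_so)), ?_⟩
    rw [← Ad_velocity, ← Ad_smul, ← Ad_add]
    congr 1
    simp only [velocity, add_mul, mul_add, smul_mul_assoc, mul_smul_comm, smul_sub]
    abel

theorem J_J_of_isTangent {t : Param n} {w : Mat n} (h : IsTangent (point t) w) :
    J (point t) (J (point t) w) = -w := by
  have ha := (preservesFlag_of_mem_SN (groupElement_mem t)).isIsometry
  obtain ⟨X, hX, rfl⟩ := h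
  have h1 : velocity X (point t) =
      Ad (groupElement t) (velocity (Ad (groupElement t)⁻¹ X) (Z n)) := by
    rw [Ad_velocity, Ad_inv_Ad, Ad_groupElement_Z]
  rw [h1, ← Ad_groupElement_Z, ← Ad_J, ← Ad_J, J_J_velocity (Ad_mem_so ha.inv hX), Ad_neg]

/-- A tangent vector w = [X, p] lies in 𝔰𝔬 together with X and p, and J w = [p, w] is the velocity
of -w at p. -/
theorem isTangent_J {t : Param n} {w : Mat n} (h : IsTangent (point t) w) :
    IsTangent (point t) (J (point t) w) := by
  have ha := (preservesFlag_of_mem_SN (groupElement_mem t)).isIsometry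
  have hp : point t ∈ so n := by
    rw [← Ad_groupElement_Z]
    exact Ad_mem_so ha Z_mem_so
  obtain ⟨X, hX, rfl⟩ := h
  refine ⟨-velocity X (point t), neg_mem (velocity_mem_so hX hp), ?_⟩
  rw [J, velocity, velocity, neg_mul, mul_neg]
  abel

/-! ### The tangent space of the orbit -/

theorem coe_expGL_inv (X : Mat n) : ((expGL X)⁻¹ : GL (Idx n) ℝ) = NormedSpace.exp (-X) := rfl

theorem fderiv_coords_point_comp (t : Param n) (u : Param n) :
    fderiv ℝ coords (point t) (fderiv ℝ point t u) = u := by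
  have h1 : HasFDerivAt (coords : Mat n → Param n) (fderiv ℝ coords (point t)) (point t) :=
    ((contDiff_coords (k := 1)).differentiable (by simp)).differentiableAt.hasFDerivAt
  have h2 : HasFDerivAt (point : Param n → Mat n) (fderiv ℝ point t) t :=
    ((contDiff_point (k := 1)).differentiable (by simp)).differentiableAt.hasFDerivAt
  have h3 := h1.comp t h2
  have h4 : (coords ∘ point : Param n → Param n) = id := funext coords_point
  rw [h4] at h3
  exact congrArg (fun L => L u) (h3.unique (hasFDerivAt_id t))

/-- The curve x ↦ (a exp(x s)).o stays in the orbit, where `point ∘ coords` is the identity.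
Differentiating this identity along the curve shows that its velocity is tangent to the
parametrization. -/
theorem fderiv_point_fderiv_coords (t s : Param n) :
    fderiv ℝ point t (fderiv ℝ coords (point t)
      (Ad (groupElement t) (velocity (sNMat n s) (Z n)))) =
      Ad (groupElement t) (velocity (sNMat n s) (Z n)) := by
  set a := groupElement t
  have hcurve : HasDerivAt (fun x : ℝ => Ad (a * expGL (x • sNMat n s)) (Z n))
      (Ad a (velocity (sNMat n s) (Z n))) 0 := by
    have e₁ := hasDerivAt_exp_smul_const (𝕂 := ℝ) (sNMat n s) (0 : ℝ)
    have e₂ := hasDerivAt_exp_smul_const (𝕂 := ℝ) (-sNMat n s) (0 : ℝ)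
    have e : HasDerivAt (fun x : ℝ => (a : Mat n) * NormedSpace.exp (x • sNMat n s) * Z n *
          NormedSpace.exp (x • (-sNMat n s)) * ((a⁻¹ : GL (Idx n) ℝ) : Mat n)) _ 0 :=
      (((e₁.const_mul (a : Mat n)).mul_const (Z n)).mul e₂).mul_const
        ((a⁻¹ : GL (Idx n) ℝ) : Mat n)
    have hfun : (fun x : ℝ => Ad (a * expGL (x • sNMat n s)) (Z n)) = fun x : ℝ =>
        (a : Mat n) * NormedSpace.exp (x • sNMat n s) * Z n *
          NormedSpace.exp (x • (-sNMat n s)) * ((a⁻¹ : GL (Idx n) ℝ) : Mat n) := by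
      funext x
      rw [Ad, _root_.mul_inv_rev, Units.val_mul, Units.val_mul, coe_expGL, coe_expGL_inv, smul_neg]
      simp only [mul_assoc]
    rw [hfun]
    refine e.congr_deriv ?_
    simp only [zero_smul, NormedSpace.exp_zero, one_mul, mul_one, mul_neg, Ad,
      velocity, sub_eq_add_neg, add_mul, mul_add, neg_mul, mul_assoc]
  have hmem (x : ℝ) : Ad (a * expGL (x • sNMat n s)) (Z n) ∈ orbitSN n :=
    ⟨_, mul_mem (groupElement_mem t) (Subgroup.subset_closure
      ⟨x • sNMat n s, Submodule.smul_mem _ _ (mem_sN_iff.2 ⟨s, rfl⟩), rfl⟩), rfl⟩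
  have h0 : Ad (a * expGL ((0 : ℝ) • sNMat n s)) (Z n) = point t := by
    have : expGL ((0 : ℝ) • sNMat n s) = 1 := Units.ext (by
      rw [coe_expGL, zero_smul, NormedSpace.exp_zero, Units.val_one])
    rw [this, mul_one, Ad_groupElement_Z]
  have h1 : HasFDerivAt (coords : Mat n → Param n) (fderiv ℝ coords (point t)) (point t) :=
    ((contDiff_coords (k := 1)).differentiable (by simp)).differentiableAt.hasFDerivAt
  have h2 : HasFDerivAt (point : Param n → Mat n) (fderiv ℝ point t) t :=
    ((contDiff_point (k := 1)).differentiable (by simp)).differentiableAt.hasFDerivAt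
  have h3 := h1.comp_hasDerivAt_of_eq 0 hcurve h0.symm
  have h4 := h2.comp_hasDerivAt_of_eq 0 h3 (by
    simp only [Function.comp_apply]
    rw [h0, coords_point])
  have h5 : (point ∘ coords ∘ fun x : ℝ => Ad (a * expGL (x • sNMat n s)) (Z n)) =
      fun x : ℝ => Ad (a * expGL (x • sNMat n s)) (Z n) :=
    funext fun x => point_coords (hmem x)
  rw [h5] at h4
  exact h4.unique hcurve

/-- The converse inclusion, by dimension: assigning to s the parameter velocity of the corresponding
tangent vector is an injective endomorphism of `Param n`, hence surjective. -/
theorem exists_fderiv_point_eq (t u : Param n) : ∃ s : Param n,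
    fderiv ℝ point t u = Ad (groupElement t) (velocity (sNMat n s) (Z n)) := by
  let Q : Param n →ₗ[ℝ] Param n :=
    { toFun := fun s => fderiv ℝ coords (point t)
        (Ad (groupElement t) (velocity (sNMat n s) (Z n)))
      map_add' := fun s s' => by
        rw [← map_add, ← Ad_add, map_add]
        congr 2
        simp only [velocity, add_mul, mul_add]
        abel
      map_smul' := fun r s => by
        rw [RingHom.id_apply, ← map_smul, ← Ad_smul, map_smul]
        congr 2
        simp only [velocity, smul_mul_assoc, mul_smul_comm, smul_sub] }
  have hinj : Function.Injective Q := by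
    refine (injective_iff_map_eq_zero Q).2 fun s hs => ?_
    have h := fderiv_point_fderiv_coords t s
    rw [show fderiv ℝ coords (point t)
        (Ad (groupElement t) (velocity (sNMat n s) (Z n))) = 0 from hs, map_zero] at h
    exact eq_zero_of_velocity_sNMat_eq_zero (Ad_eq_zero h.symm)
  obtain ⟨s, rfl⟩ := LinearMap.injective_iff_surjective.1 hinj u
  exact ⟨s, fderiv_point_fderiv_coords t s⟩

end Tangent

/-! ### The induced structure in coordinates -/

section Coordinates

variable {n : ℕ}

/-- The metric as a continuous bilinear map. -/
def metricL (n : ℕ) : Mat n →L[ℝ] Mat n →L[ℝ] ℝ :=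
  (LinearMap.mk₂ ℝ (metric : Mat n → Mat n → ℝ)
    (fun u v w => by simp only [metric, add_mul, trace_add, mul_add])
    (fun r u v => by simp only [metric, smul_mul_assoc, trace_smul, smul_eq_mul]; ring)
    (fun u v w => by simp only [metric, mul_add, trace_add])
    (fun r u v => by
      simp only [metric, mul_smul_comm, trace_smul, smul_eq_mul]; ring)).toContinuousBilinearMap

theorem metricL_apply (u v : Mat n) : metricL n u v = metric u v := rfl

/-- The complex structure as a continuous bilinear map. -/
def JL (n : ℕ) : Mat n →L[ℝ] Mat n →L[ℝ] Mat n :=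
  (LinearMap.mk₂ ℝ (J : Mat n → Mat n → Mat n)
    (fun u v w => by simp only [J, add_mul, mul_add]; abel)
    (fun r u v => by simp only [J, smul_mul_assoc, mul_smul_comm, smul_sub])
    (fun u v w => by simp only [J, add_mul, mul_add]; abel)
    (fun r u v => by
      simp only [J, smul_mul_assoc, mul_smul_comm, smul_sub])).toContinuousBilinearMap

theorem JL_apply (p u : Mat n) : JL n p u = J p u := rfl

/-- The form of signature `(2, n + 1)` as a continuous bilinear map. -/
def formL (n : ℕ) : (Idx n → ℝ) →L[ℝ] (Idx n → ℝ) →L[ℝ] ℝ :=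
  (LinearMap.mk₂ ℝ (form : (Idx n → ℝ) → (Idx n → ℝ) → ℝ)
    (fun u v w => by simp only [form, add_dotProduct])
    (fun r u v => by simp only [form, smul_dotProduct, smul_eq_mul])
    (fun u v w => by simp only [form, mulVec_add, dotProduct_add])
    (fun r u v => by
      simp only [form, mulVec_smul, dotProduct_smul, smul_eq_mul])).toContinuousBilinearMap

/-- Evaluation of matrices at the isotropic vector `e₁ + e₃`. -/
def evalNull (n : ℕ) : Mat n →L[ℝ] (Idx n → ℝ) :=
  LinearMap.toContinuousLinearMap
    { toFun := fun w => w *ᵥ vec 1 0 1 0 0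
      map_add' := fun u v => add_mulVec u v _
      map_smul' := fun r u => smul_mulVec r u _ }

theorem evalNull_apply (w : Mat n) : evalNull n w = w *ᵥ vec 1 0 1 0 0 := rfl

theorem hasFDerivAt_point (t : Param n) : HasFDerivAt point (fderiv ℝ point t) t :=
  ((contDiff_point (k := 1)).differentiable (by simp)).differentiableAt.hasFDerivAt

/-- Differentiating `point_mulVec_null`, in which e₁ + e₃ is constant, gives the derivative of the
frame in terms of translated vectors from o, so that `hyp` is never differentiated explicitly. -/
theorem fderiv_frame₂ (t u : Param n) :
    fderiv ℝ frame₂ t u = -(fderiv ℝ point t u *ᵥ vec 1 0 1 0 0) := by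
  have h : (frame₂ : Param n → Idx n → ℝ) = fun t => -(evalNull n (point t)) := by
    funext t
    rw [evalNull_apply, point_mulVec_null, neg_neg]
  have h2 := ((evalNull n).hasFDerivAt.comp t (hasFDerivAt_point t)).neg
  have h3 : HasFDerivAt frame₂ (-((evalNull n).comp (fderiv ℝ point t))) t := by
    rw [h]
    exact h2
  rw [h3.fderiv]
  rfl

theorem fderiv_frame₁ (t u : Param n) :
    fderiv ℝ frame₁ t u =
      -((point t * fderiv ℝ point t u + fderiv ℝ point t u * point t) *ᵥ vec 1 0 1 0 0) := by
  have h : (frame₁ : Param n → Idx n → ℝ) = fun t => -(evalNull n (point t * point t)) := by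
    funext t
    rw [evalNull_apply, point_mul_point_mulVec_null, neg_neg]
  have h1 := (hasFDerivAt_point t).mul' (hasFDerivAt_point t)
  have h2 := ((evalNull n).hasFDerivAt.comp t h1).neg
  have h3 := h2.congr_of_eventuallyEq (f₁ := frame₁) (Filter.Eventually.of_forall (congrFun h))
  rw [h3.fderiv]
  rfl

/-- This identifies η with a multiple of the connection form ⟨F₁, dF₂⟩. At o the vector -Jν is -N,
and both sides equal k₂/2 in the parameters of 𝔰_N. -/
theorem metric_fderiv_point_J_normalAt (t u : Param n) :
    metric (fderiv ℝ point t u) (-J (point t) (normalAt t)) =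
      -(1 / 2) * form (frame₁ t) (fderiv ℝ frame₂ t u) := by
  have hf := preservesFlag_of_mem_SN (groupElement_mem t)
  have hν := Ad_velocity_N_eq_normalAt (groupElement_mem t) (groupElement_mulVec_e₁ t)
    (groupElement_mulVec_e₂ t)
  obtain ⟨⟨r, y, k₂, k₄, k⟩, hs⟩ := exists_fderiv_point_eq t u
  rw [fderiv_frame₂, hs, ← hν, ← Ad_groupElement_Z, ← Ad_J, J_velocity_N, ← Ad_neg, metric_Ad]
  have h1 : Ad (groupElement t) (velocity (sNMat n (r, y, k₂, k₄, k)) (Z n)) *ᵥ vec 1 0 1 0 0 =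
      (groupElement t : Mat n) *ᵥ
        (velocity (sNMat n (r, y, k₂, k₄, k)) (Z n) *ᵥ vec 1 0 1 0 0) := by
    conv_lhs => rw [← hf.map_null, Ad_mul_inv_cancel]
  rw [h1, ← groupElement_mulVec_e₁, ← mulVec_neg, hf.isIsometry.form_mulVec, metric, mul_neg,
    trace_neg, trace_mul_N, velocity_sNMat_mulVec, velocity_sNMat_mulVec, velocity_sNMat_mulVec,
    ← neg_one_smul ℝ (vec _ _ _ _ _), smul_vec, form_vec, c₀_sq]
  simp [vec]
  ring

/-- The Kähler form as a multiple of the curvature of the tautological plane bundle. Both sides are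
invariant under the group; at o one has dF₁ = (0, k₂, 0, k₄, k) and dF₂ = (-k₂, 0, -k₂, r, y), and
`metric_J_velocity` gives the same expression. -/
theorem metric_J_fderiv_point (t u v : Param n) :
    metric (fderiv ℝ point t u) (J (point t) (fderiv ℝ point t v)) =
      -(1 / 4) * (form (fderiv ℝ frame₁ t u) (fderiv ℝ frame₂ t v) -
        form (fderiv ℝ frame₁ t v) (fderiv ℝ frame₂ t u)) := by
  have hf := preservesFlag_of_mem_SN (groupElement_mem t)
  have key (w : Mat n) : Ad (groupElement t) w *ᵥ vec 1 0 1 0 0 =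
      (groupElement t : Mat n) *ᵥ (w *ᵥ vec 1 0 1 0 0) := by
    conv_lhs => rw [← hf.map_null, Ad_mul_inv_cancel]
  obtain ⟨⟨r, y, k₂, k₄, k⟩, hs⟩ := exists_fderiv_point_eq t u
  obtain ⟨⟨r', y', k₂', k₄', k'⟩, hs'⟩ := exists_fderiv_point_eq t v
  rw [fderiv_frame₂, fderiv_frame₂, fderiv_frame₁, fderiv_frame₁, hs, hs', ← Ad_groupElement_Z,
    ← Ad_J, metric_Ad, metric_J_velocity]
  simp only [← Ad_mul, ← Ad_add, key, ← mulVec_neg, hf.isIsometry.form_mulVec]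
  simp only [add_mulVec, ← mulVec_mulVec, velocity_sNMat_mulVec, Z_mulVec, vec_add,
    ← neg_one_smul ℝ (vec _ _ _ _ _ : Idx n → ℝ), smul_vec, form_vec]
  simp [dotProduct_comm k, dotProduct_comm k' y]
  ring


theorem isTangent_iff_fderiv (t : Param n) (w : Mat n) :
    IsTangent (point t) w ↔ ∃ (u : Param n) (r : ℝ), w = fderiv ℝ point t u + r • normalAt t := by
  rw [isTangent_iff]
  constructor
  · rintro ⟨s, r, rfl⟩
    exact ⟨_, r, by rw [fderiv_point_fderiv_coords]⟩
  · rintro ⟨u, r, rfl⟩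
    obtain ⟨s, hs⟩ := exists_fderiv_point_eq t u
    exact ⟨s, r, by rw [hs]⟩

theorem isTangent_fderiv (t u : Param n) : IsTangent (point t) (fderiv ℝ point t u) :=
  (isTangent_iff_fderiv t _).2 ⟨u, 0, by simp⟩

theorem isTangent_normalAt (t : Param n) : IsTangent (point t) (normalAt t) :=
  (isTangent_iff_fderiv t _).2 ⟨0, 1, by simp⟩

theorem metric_normalAt_self (t : Param n) : metric (normalAt t) (normalAt t) = 1 := by
  rw [← Ad_velocity_N_eq_normalAt (groupElement_mem t) (groupElement_mulVec_e₁ t)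
    (groupElement_mulVec_e₂ t), metric_Ad]
  exact modelInner_N_N

theorem metric_fderiv_normalAt (t u : Param n) :
    metric (fderiv ℝ point t u) (normalAt t) = 0 := by
  obtain ⟨s, hs⟩ := exists_fderiv_point_eq t u
  rw [← Ad_velocity_N_eq_normalAt (groupElement_mem t) (groupElement_mulVec_e₁ t)
    (groupElement_mulVec_e₂ t), hs, metric_Ad]
  exact modelInner_sNMat_N s

theorem metric_fderiv_self_pos (t : Param n) {u : Param n} (hu : u ≠ 0) :
    0 < metric (fderiv ℝ point t u) (fderiv ℝ point t u) := by
  obtain ⟨s, hs⟩ := exists_fderiv_point_eq t u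
  have hs0 : s ≠ 0 := by
    rintro rfl
    apply hu
    rw [← fderiv_coords_point_comp t u, hs]
    simp [velocity, Ad]
  rw [hs, metric_Ad, metric, c₀_sq]
  have := trace_velocity_mul_self_pos hs0
  positivity

/-- As `coords` is defined on all matrices, its derivative takes any ambient vector to a parameter
velocity. On vectors tangent to the orbit nothing is lost, which allows ξ and φ to be defined in the
chart by smooth formulas. -/
theorem fderiv_point_retraction {t : Param n} {w : Mat n} (hw : IsTangent (point t) w)
    (hν : metric w (normalAt t) = 0) :
    fderiv ℝ point t (fderiv ℝ coords (point t) w) = w := by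
  obtain ⟨u, r, rfl⟩ := (isTangent_iff_fderiv t w).1 hw
  have h : metric (fderiv ℝ point t u + r • normalAt t) (normalAt t) =
      metric (fderiv ℝ point t u) (normalAt t) + r * metric (normalAt t) (normalAt t) := by
    rw [← metricL_apply, map_add, map_smul]
    rfl
  rw [h, metric_fderiv_normalAt, metric_normalAt_self, zero_add, mul_one] at hν
  rw [hν, zero_smul, add_zero, fderiv_coords_point_comp]

theorem metric_J_self (p w : Mat n) : metric w (J p w) = 0 := by
  have h := metric_J_left p w w
  rw [metric_comm] at h
  linarith

end Coordinates

/-! ### The structure tensors in a linear chart and their identities -/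

section Structure

variable {n : ℕ} {E : Type*} [NormedAddCommGroup E] [NormedSpace ℝ E] (c : E ≃L[ℝ] Param n)

/-- The differential of the parametrization of the orbit. -/
def dParam (t : E) : E →L[ℝ] Mat n := (fderiv ℝ point (c t)).comp (c : E →L[ℝ] Param n)

/-- The differential of the chart of the orbit. -/
def dChart (t : E) : Mat n →L[ℝ] E :=
  (c.symm : Param n →L[ℝ] E).comp (fderiv ℝ coords (point (c t)))

/-- The induced metric in the chart. -/
def chartMetric (t : E) : E →L[ℝ] E →L[ℝ] ℝ := (metricL n).bilinearComp (dParam c t) (dParam c t)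

/-- The characteristic vector field in the chart. -/
def chartξ (t : E) : E := dChart c t (-J (point (c t)) (normalAt (c t)))

/-- The contact form in the chart. -/
def chartη (t : E) : E →L[ℝ] ℝ :=
  -- The connection form is taken as the definition, in place of g(·, ξ), because its derivative is
  -- immediate; `chartη_eq` links the two.
  (-(1 / 2) : ℝ) • (formL n (frame₁ (c t))).comp (fderiv ℝ (frame₂ ∘ c) t)

/-- The structure tensor in the chart. -/
def chartφ (t : E) : E →L[ℝ] E :=
  (dChart c t).comp
    ((JL n (point (c t))).comp (dParam c t) - (chartη c t).smulRight (normalAt (c t)))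

theorem dParam_apply (t u : E) : dParam c t u = fderiv ℝ point (c t) (c u) := rfl

theorem isTangent_dParam (t u : E) : IsTangent (point (c t)) (dParam c t u) :=
  isTangent_fderiv _ _

theorem dParam_eq (t : E) : dParam c t = fderiv ℝ (point ∘ c) t := c.comp_right_fderiv.symm

theorem fderiv_comp_chart {W : Type*} [NormedAddCommGroup W] [NormedSpace ℝ W] (f : Param n → W)
    (t u : E) : fderiv ℝ (f ∘ c) t u = fderiv ℝ f (c t) (c u) := by
  rw [c.comp_right_fderiv]
  rfl

theorem dChart_dParam (t u : E) : dChart c t (dParam c t u) = u := by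
  change c.symm (fderiv ℝ coords (point (c t)) (fderiv ℝ point (c t) (c u))) = u
  rw [fderiv_coords_point_comp, c.symm_apply_apply]

theorem dParam_injective (t : E) : Function.Injective (dParam c t) :=
  Function.LeftInverse.injective (dChart_dParam c t)

theorem dParam_dChart {t : E} {w : Mat n} (hw : IsTangent (point (c t)) w)
    (hν : metric w (normalAt (c t)) = 0) : dParam c t (dChart c t w) = w := by
  change fderiv ℝ point (c t) (c (c.symm (fderiv ℝ coords (point (c t)) w))) = w
  rw [c.apply_symm_apply, fderiv_point_retraction hw hν]

theorem chartMetric_apply (t u v : E) :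
    chartMetric c t u v = metric (dParam c t u) (dParam c t v) := rfl

theorem chartη_eq (t u : E) :
    chartη c t u = metric (dParam c t u) (-J (point (c t)) (normalAt (c t))) := by
  rw [dParam_apply, metric_fderiv_point_J_normalAt, ← fderiv_comp_chart]
  rfl

theorem metric_neg_right (u v : Mat n) : metric u (-v) = -metric u v :=
  map_neg (metricL n u) v

theorem metric_sub_smul_left (u v w : Mat n) (r : ℝ) :
    metric (u - r • v) w = metric u w - r * metric v w := by
  rw [← metricL_apply, map_sub, map_smul]
  rfl

theorem metric_sub_smul_right (u v w : Mat n) (r : ℝ) :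
    metric w (u - r • v) = metric w u - r * metric w v := by
  rw [metric_comm, metric_sub_smul_left, metric_comm u, metric_comm v]

theorem chartη_eq_metric_J (t u : E) :
    chartη c t u = metric (J (point (c t)) (dParam c t u)) (normalAt (c t)) := by
  rw [chartη_eq, metric_neg_right, metric_J_left]

theorem dParam_chartξ (t : E) :
    dParam c t (chartξ c t) = -J (point (c t)) (normalAt (c t)) := by
  refine dParam_dChart c ?_ ?_
  · obtain ⟨X, hX, h⟩ := isTangent_J (isTangent_normalAt (c t))
    refine ⟨-X, neg_mem hX, ?_⟩
    rw [h, velocity, velocity, neg_mul, mul_neg]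
    abel
  · rw [metric_comm, metric_neg_right, metric_J_self, neg_zero]

theorem isTangent_sub_smul {p u v : Mat n} (hu : IsTangent p u) (hv : IsTangent p v) (r : ℝ) :
    IsTangent p (u - r • v) := by
  obtain ⟨X, hX, rfl⟩ := hu
  obtain ⟨Y, hY, rfl⟩ := hv
  refine ⟨X - r • Y, sub_mem hX (Submodule.smul_mem _ r hY), ?_⟩
  simp only [velocity, sub_mul, mul_sub, smul_mul_assoc, mul_smul_comm, smul_sub]
  abel

theorem dParam_chartφ (t u : E) :
    dParam c t (chartφ c t u) =
      J (point (c t)) (dParam c t u) - chartη c t u • normalAt (c t) := by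
  refine dParam_dChart c (w := J (point (c t)) (dParam c t u) - chartη c t u • normalAt (c t))
    (isTangent_sub_smul (isTangent_J (isTangent_fderiv _ _)) (isTangent_normalAt _) _) ?_
  rw [metric_sub_smul_left, metric_normalAt_self, chartη_eq_metric_J, mul_one, sub_self]

theorem metric_dParam_normalAt (t u : E) : metric (dParam c t u) (normalAt (c t)) = 0 :=
  metric_fderiv_normalAt _ _

theorem chartη_chartξ (t : E) : chartη c t (chartξ c t) = 1 := by
  rw [chartη_eq, dParam_chartξ, metric_neg_right, metric_comm, metric_neg_right, neg_neg,
    metric_J_left, J_J_of_isTangent (isTangent_normalAt _), metric_neg_right, neg_neg,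
    metric_normalAt_self]

theorem chartη_chartφ (t u : E) : chartη c t (chartφ c t u) = 0 := by
  rw [chartη_eq, dParam_chartφ, metric_sub_smul_left, metric_neg_right, metric_neg_right,
    metric_J_self, metric_J_left, J_J_of_isTangent (isTangent_normalAt _), metric_neg_right,
    metric_dParam_normalAt]
  simp

theorem chartφ_chartφ (t u : E) :
    chartφ c t (chartφ c t u) = -u + chartη c t u • chartξ c t := by
  apply dParam_injective c t
  have hJ (p v w : Mat n) (r : ℝ) : J p (v - r • w) = J p v - r • J p w := by
    rw [← JL_apply, map_sub, map_smul]
    rfl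
  rw [dParam_chartφ, chartη_chartφ, dParam_chartφ, hJ,
    J_J_of_isTangent (isTangent_dParam c _ _), map_add, map_neg, map_smul, dParam_chartξ]
  simp only [zero_smul, sub_zero, smul_neg]
  exact sub_eq_add_neg _ _

theorem chartMetric_chartφ (t u v : E) :
    chartMetric c t (chartφ c t u) (chartφ c t v) =
      chartMetric c t u v - chartη c t u * chartη c t v := by
  have hJν (w : E) : metric (normalAt (c t)) (J (point (c t)) (dParam c t w)) = chartη c t w := by
    rw [metric_comm, chartη_eq_metric_J]
  rw [chartMetric_apply, chartMetric_apply, dParam_chartφ, dParam_chartφ, metric_sub_smul_left,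
    metric_sub_smul_right, metric_sub_smul_right, hJν, metric_normalAt_self,
    ← chartη_eq_metric_J, metric_J_left, J_J_of_isTangent (isTangent_dParam c _ _),
    metric_neg_right]
  ring

theorem contDiff_dParam : ContDiff ℝ ∞ (dParam c) := by
  have h : dParam c = fderiv ℝ (point ∘ c) := funext (dParam_eq c)
  rw [h]
  exact ((contDiff_point (k := ∞)).comp c.contDiff).fderiv_right (by simp)

theorem contDiff_dChart : ContDiff ℝ ∞ (dChart c) := by
  have h1 : ContDiff ℝ ∞ (fderiv ℝ (coords : Mat n → Param n)) :=
    (contDiff_coords (k := ∞)).fderiv_right (by simp)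
  exact contDiff_const.clm_comp (h1.comp (contDiff_point.comp c.contDiff))

theorem contDiff_chartη : ContDiff ℝ ∞ (chartη c) := by
  have h1 : ContDiff ℝ ∞ (fderiv ℝ ((frame₂ : Param n → Idx n → ℝ) ∘ c)) :=
    ((contDiff_frame₂ (k := ∞)).comp c.contDiff).fderiv_right (by simp)
  exact (((formL n).contDiff.comp (contDiff_frame₁.comp c.contDiff)).clm_comp h1).const_smul _

theorem contDiff_J_normalAt :
    ContDiff ℝ ∞ fun t : E => -J (point (c t)) (normalAt (c t)) :=
  (((JL n).contDiff.comp (contDiff_point.comp c.contDiff)).clm_apply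
    (contDiff_normalAt.comp c.contDiff)).neg

theorem contDiff_chartξ : ContDiff ℝ ∞ (chartξ c) :=
  (contDiff_dChart c).clm_apply (contDiff_J_normalAt c)

theorem contDiff_chartφ [FiniteDimensional ℝ E] : ContDiff ℝ ∞ (chartφ c) := by
  refine (contDiff_dChart c).clm_comp ?_
  refine ContDiff.sub ?_ ?_
  · exact ((JL n).contDiff.comp (contDiff_point.comp c.contDiff)).clm_comp (contDiff_dParam c)
  · exact (contDiff_chartη c).smulRight (contDiff_normalAt.comp c.contDiff)

theorem contDiff_chartMetric [FiniteDimensional ℝ E] : ContDiff ℝ ∞ (chartMetric c) := by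
  refine contDiff_clm_apply_iff.2 fun u => contDiff_clm_apply_iff.2 fun v => ?_
  have h (w : E) : ContDiff ℝ ∞ fun t => dParam c t w :=
    (contDiff_dParam c).clm_apply contDiff_const
  exact ((metricL n).contDiff.comp (h u)).clm_apply (h v)

theorem chartMetric_pos (t v : E) (hv : v ≠ 0) : 0 < chartMetric c t v v :=
  metric_fderiv_self_pos _ (by simpa using hv)

theorem fderiv_chartη (t u v : E) :
    fderiv ℝ (chartη c) t u v =
      -(1 / 2) * (form (frame₁ (c t)) (fderiv ℝ (fderiv ℝ (frame₂ ∘ c)) t u v) +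
        form (fderiv ℝ frame₁ (c t) (c u)) (fderiv ℝ frame₂ (c t) (c v))) := by
  have h1 : HasFDerivAt (fderiv ℝ ((frame₂ : Param n → Idx n → ℝ) ∘ c)) _ t :=
    ((((contDiff_frame₂ (k := ∞)).comp c.contDiff).fderiv_right
      (m := ∞) (by simp)).differentiable (by simp)).differentiableAt.hasFDerivAt
  have h2 : HasFDerivAt ((frame₁ : Param n → Idx n → ℝ) ∘ c) _ t :=
    (((contDiff_frame₁ (k := ∞)).comp c.contDiff).differentiable
      (by simp)).differentiableAt.hasFDerivAt
  have h3 := (((formL n).hasFDerivAt.comp t h2).clm_comp h1).const_smul (-(1 / 2) : ℝ)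
  have h4 : HasFDerivAt (chartη c) _ t := h3
  rw [h4.fderiv, ← fderiv_comp_chart, ← fderiv_comp_chart]
  rfl

/-- The contact condition itself. The normal part of φ is orthogonal to the orbit, so the left side
is the Kähler form; on the right the symmetric second derivative of `frame₂` cancels, and
`metric_J_fderiv_point` matches what is left. -/
theorem chartMetric_chartφ_eq (t u v : E) : chartMetric c t u (chartφ c t v) =
    (1 / 2) * (fderiv ℝ (chartη c) t u v - fderiv ℝ (chartη c) t v u) := by
  have hsymm := ((contDiff_frame₂ (n := n) (k := 2)).comp c.contDiff).contDiffAt.isSymmSndFDerivAt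
    (x := t) (by simp)
  rw [fderiv_chartη, fderiv_chartη, hsymm.eq u v, chartMetric_apply, dParam_chartφ,
    metric_sub_smul_right, metric_dParam_normalAt, dParam_apply, dParam_apply,
    metric_J_fderiv_point]
  ring

theorem SN_le_SO₀ : SN n ≤ SO₀ n := by
  refine Subgroup.closure_mono ?_
  rintro a ⟨X, hX, h⟩
  obtain ⟨t, rfl⟩ := mem_sN_iff.1 hX
  exact ⟨_, sNMat_mem_so t, h⟩

theorem orbitSN_subset_grassmannian : orbitSN n ⊆ grassmannian n := by
  rintro p ⟨a, ha, rfl⟩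
  exact ⟨a, SN_le_SO₀ ha, rfl⟩

theorem normalAt_coords {a : GL (Idx n) ℝ} (ha : a ∈ SN n) :
    normalAt (coords (Ad a (Z n))) = Ad a (velocity (N n) (Z n)) := by
  obtain ⟨h₁, h₂⟩ := frame_eq_of_mem_SN ha
  exact (Ad_velocity_N_eq_normalAt ha h₁ h₂).symm

end Structure

/-- The chart of the orbit with values in a Euclidean space. -/
def orbitChart {n : ℕ} {E : Type*} [NormedAddCommGroup E] [NormedSpace ℝ E]
    (c : E ≃L[ℝ] Param n) : orbitSN n ≃ₜ E :=
  (orbitHomeomorph n).trans c.symm.toHomeomorph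

/-! ### The orbit as a hypersurface with its induced contact metric structure -/

section Hypersurface

variable {n : ℕ} {E : Type*} [NormedAddCommGroup E] [NormedSpace ℝ E] {c : E ≃L[ℝ] Param n}

theorem apply_orbitChart (x : orbitSN n) : c (orbitChart c x) = coords x.1 :=
  c.apply_symm_apply _

theorem point_orbitChart (x : orbitSN n) : point (c (orbitChart c x)) = x.1 := by
  rw [apply_orbitChart, point_coords x.2]

theorem val_comp_orbitChart_symm :
    (Subtype.val : orbitSN n → Mat n) ∘ (orbitChart c).symm = point ∘ c := rfl

variable [ChartedSpace E (orbitSN n)] (he : IsGlobalChart (orbitChart c))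
include he

theorem differential_val (x : orbitSN n) (u : TangentSpace 𝓘(ℝ, E) x) :
    differential 𝓘(ℝ, E) (Subtype.val : orbitSN n → Mat n) x u = dParam c (orbitChart c x) u := by
  have hd : DifferentiableAt ℝ ((Subtype.val : orbitSN n → Mat n) ∘ (orbitChart c).symm)
      (orbitChart c x) := by
    rw [val_comp_orbitChart_symm]
    exact (((contDiff_point (k := 1)).comp c.contDiff).differentiable (by simp)).differentiableAt
  exact congrArg (fun L : E →L[ℝ] Mat n => L u)
    ((he.differential_eq hd).trans (dParam_eq c _).symm)

theorem isHypersurfaceWithUnitNormal :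
    IsHypersurfaceWithUnitNormal 𝓘(ℝ, E) (Subtype.val : orbitSN n → Mat n)
      (fun x => normalAt (coords x.1)) where
  isEmbedding := Topology.IsEmbedding.subtypeVal
  contMDiff := he.contMDiff_iff.2 (contDiff_point.comp c.contDiff)
  injective_mfderiv x u v h := by
    rw [differential_val he, differential_val he] at h
    exact dParam_injective c _ h
  mem x := orbitSN_subset_grassmannian x.2
  contMDiff_normal := he.contMDiff_iff.2
    (contDiff_normalAt.comp (contDiff_coords.comp (contDiff_point.comp c.contDiff)))
  isTangent_normal x := by
    have h := isTangent_normalAt (c (orbitChart c x))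
    rwa [point_orbitChart, apply_orbitChart] at h
  unit x := metric_normalAt_self _
  normal x u := by
    rw [differential_val he, ← apply_orbitChart (c := c)]
    exact metric_dParam_normalAt c _ u
  codim_one x w := by
    have h := isTangent_iff_fderiv (c (orbitChart c x)) w
    rw [point_orbitChart, apply_orbitChart] at h
    rw [h]
    constructor
    · rintro ⟨u, r, rfl⟩
      refine ⟨c.symm u, r, ?_⟩
      have hu : dParam c (orbitChart c x) (c.symm u) = fderiv ℝ point (coords x.1) u := by
        rw [dParam_apply, c.apply_symm_apply, apply_orbitChart]
      exact congrArg (fun w : Mat n => w + r • normalAt (coords x.1))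
        (hu.symm.trans (differential_val he x (c.symm u : E)).symm)
    · rintro ⟨u, r, rfl⟩
      refine ⟨c u, r, ?_⟩
      rw [differential_val he, ← apply_orbitChart (c := c)]
      rfl

variable [FiniteDimensional ℝ E] [IsManifold 𝓘(ℝ, E) ∞ (orbitSN n)]

/-- The almost contact metric structure of the orbit. -/
def orbitStructure : AlmostContactMetricStructure 𝓘(ℝ, E) (orbitSN n) :=
  he.almostContactMetricStructure (chartMetric c) (chartξ c) (chartη c) (chartφ c)
    (contDiff_chartMetric c) (contDiff_chartξ c) (contDiff_chartη c) (contDiff_chartφ c)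
    (fun _ _ _ => metric_comm _ _) (chartMetric_pos c) (chartη_chartξ c) (chartφ_chartφ c)
    (chartMetric_chartφ c)

theorem isInducedStructure_orbitStructure :
    IsInducedStructure 𝓘(ℝ, E) (Subtype.val : orbitSN n → Mat n)
      (fun x => normalAt (coords x.1)) (orbitStructure he) where
  metric_eq x u v := by
    rw [differential_val he, differential_val he]
    rfl
  ξ_eq x := by
    rw [differential_val he, ← apply_orbitChart (c := c)]
    refine (dParam_chartξ c (orbitChart c x)).trans ?_
    rw [point_orbitChart]
  η_eq x u := by
    refine (chartη_eq c (orbitChart c x) u).trans ?_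
    rw [← dParam_chartξ]
    rfl
  φ_eq x u := by
    rw [differential_val he, differential_val he, ← apply_orbitChart (c := c)]
    refine (dParam_chartφ c (orbitChart c x) u).trans ?_
    rw [point_orbitChart]
    rfl

theorem isContactMetric_orbitStructure : (orbitStructure he).IsContactMetric := fun x X Y hX hY =>
  (chartMetric_chartφ_eq c (orbitChart c x) (X x) (Y x)).trans
    (he.extDerivOneForm_eq (contDiff_chartη c) hX hY).symm

end Hypersurface

end LieHypersurface
end

/-- Let `n ≥ 2`. The orbit map `a ↦ a.o` identifies the group `S_N` with the orbit `S_N.o`. The orbit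
is an embedded real hypersurface of `G₂*(ℝ^{n+3})`, of dimension `2 n + 1`, with the `S_N`-invariant
unit normal field `ν` whose value at `a.o` is the translate by `a` of the value `d/dt exp(tN).o` at
`o`, and with the structure induced from the Grassmannian it is a contact metric manifold. -/
theorem mainTheorem6 (n : ℕ) (hn : 2 ≤ n) :
    Topology.IsEmbedding
        (fun a : LieHypersurface.SN n => LieHypersurface.Ad a.1 (LieHypersurface.Z n)) ∧
    ∃ (_ : ChartedSpace (EuclideanSpace ℝ (Fin (2 * n + 1))) (LieHypersurface.orbitSN n))
      (_ : IsManifold 𝓘(ℝ, EuclideanSpace ℝ (Fin (2 * n + 1))) ∞ (LieHypersurface.orbitSN n))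
      (ν : LieHypersurface.orbitSN n → LieHypersurface.Mat n)
      (s : LieHypersurface.AlmostContactMetricStructure
        𝓘(ℝ, EuclideanSpace ℝ (Fin (2 * n + 1))) (LieHypersurface.orbitSN n)),
      (∀ (x : LieHypersurface.orbitSN n), ∀ a ∈ LieHypersurface.SN n,
        x.1 = LieHypersurface.Ad a (LieHypersurface.Z n) →
        ν x = LieHypersurface.Ad a
          (LieHypersurface.velocity (LieHypersurface.N n) (LieHypersurface.Z n))) ∧
      LieHypersurface.IsHypersurfaceWithUnitNormal
        𝓘(ℝ, EuclideanSpace ℝ (Fin (2 * n + 1))) (Subtype.val : LieHypersurface.orbitSN n → _) ν ∧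
      LieHypersurface.IsInducedStructure
        𝓘(ℝ, EuclideanSpace ℝ (Fin (2 * n + 1))) (Subtype.val : LieHypersurface.orbitSN n → _) ν s ∧
      s.IsContactMetric := by
  refine ⟨LieHypersurface.isEmbedding_orbitMap n, ?_⟩
  -- The parameters number 1 + (n - 1) + 1 + 1 + (n - 1) = 2n + 1, where the truncated subtraction
  -- requires n ≥ 1.
  have hdim : Module.finrank ℝ (EuclideanSpace ℝ (Fin (2 * n + 1))) =
      Module.finrank ℝ (LieHypersurface.Param n) := by
    simp only [finrank_euclideanSpace, Fintype.card_fin, Module.finrank_prod, Module.finrank_self,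
      Module.finrank_fintype_fun_eq_card]
    omega
  let c := ContinuousLinearEquiv.ofFinrankEq hdim
  let e := (LieHypersurface.orbitChart c).toOpenPartialHomeomorph
  let _ : ChartedSpace (EuclideanSpace ℝ (Fin (2 * n + 1))) (LieHypersurface.orbitSN n) :=
    e.singletonChartedSpace rfl
  have hM : IsManifold 𝓘(ℝ, EuclideanSpace ℝ (Fin (2 * n + 1))) ∞ (LieHypersurface.orbitSN n) :=
    e.isManifold_singleton rfl
  have he : LieHypersurface.IsGlobalChart (LieHypersurface.orbitChart c) :=
    fun x => e.singletonChartedSpace_chartAt_eq rfl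
  refine ⟨inferInstance, hM, fun x => LieHypersurface.normalAt (LieHypersurface.coords x.1),
    LieHypersurface.orbitStructure he, ?_, LieHypersurface.isHypersurfaceWithUnitNormal he,
    LieHypersurface.isInducedStructure_orbitStructure he,
    LieHypersurface.isContactMetric_orbitStructure he⟩
  intro x a ha hx
  simp only [hx]
  exact LieHypersurface.normalAt_coords ha
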